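/- Let $(X_{ij})_{(i,j)\in\mathbb{Z}^2}$ be real-valued, centered, square-integrable random variables on a probability space $(\Omega,\mathcal{F},\mathbb{P})$, and put $\sigma_{ij}^2=\mathbb{E}(X_{ij}^2)$. Let $(Y_{ij})_{i,j\ge 1}$ be independent centered real Gaussian random variables on the same probability space with $\mathbb{E}(Y_{ij}^2)=\sigma_{ij}^2$, and assume that the family $(Y_{ij})_{i,j\ge 1}$ is independent of the family $(X_{ij})_{(i,j)\in\mathbb{Z}^2}$. For $n\ge 1$ let $\mathbf{X}_n$ be the symmetric $n\times n$ matrix with $(\mathbf{X}_n)_{ij}=X_{ij}$ for $i\ge j$ and $(\mathbf{X}_n)_{ij}=X_{ji}$ for $i<j$; let $\mathbb{X}_n=n^{-1/2}\mathbf{X}_n$, and define $\mathbf{Y}_n$ and $\mathbb{Y}_n$ in the same way from $(Y_{ij})$. For a real symmetric $n\times n$ matrix $A$ with eigenvalues $\lambda_1,\dots,\lambda_n$ (counted with multiplicity) and for $z\in\mathbb{C}^+=\{z\in\mathbb{C}:\operatorname{Im}z>0\}$, let $$S^{A}(z)=\frac1n\sum_{k=1}^n\frac{1}{\lambda_k-z}=\frac1n\operatorname{Tr}\,(A-zI_n)^{-1}$$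 be the Stieltjes transform of the empirical spectral distribution of $A$. Write $(u,v)\le_{\mathrm{lex}}(i,j)$ if $u<i$, or $u=i$ and $v\le j$. For an integer $a\ge 0$ and $j\le i$ let $$B_{ij}^a=\{(u,v)\in\mathbb{Z}^2:\ \max(|u-i|,|v-j|)\ge a,\ (u,v)\le_{\mathrm{lex}}(i,j)\},\qquad \mathcal{F}_{ij}^a=\sigma\big(X_{uv}:(u,v)\in B_{ij}^a,\ v\le u\big).$$ Assume that for all $1\le j\le i$, $$\mathbb{E}(X_{ij}\mid\mathcal{F}_{ij}^1)=0\quad\text{a.s.},$$ that $$\sup_{n\ge1}\frac1{n^2}\sum_{1\le j\le i\le n}\sigma_{ij}^2<\infty,$$ that $$\lim_{a\to\infty}\limsup_{n\to\infty}\frac1{n^2}\sum_{1\le j\le i\le n}\big\|\mathbb{E}(X_{ij}^2-\sigma_{ij}^2\mid\mathcal{F}_{ij}^a)\big\|_1=0,$$ where $\|\cdot\|_1$ is the $L^1(\mathbb{P})$ norm, and that for every $\varepsilon>0$, $$\lim_{n\to\infty}\frac1{n^2}\sum_{1\le j\le i\le n}\mathbb{E}\big(X_{ij}^2\,\mathbf{1}_{\{|X_{ij}|>\varepsilon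 n^{1/2}\}}\big)=0 .$$ Then, for every $z\in\mathbb{C}^+$, $$S^{\mathbb{X}_n}(z)-S^{\mathbb{Y}_n}(z)\to 0\quad\text{in probability as }n\to\infty.$$ -/

import Mathlib

open MeasureTheory ProbabilityTheory Filter Topology
open scoped ENNReal NNReal

namespace MartingaleMatrix

noncomputable section

/-- The sum over all pairs `(i, j)` with `1 ≤ j ≤ i ≤ n`. -/
def lowerSum {M : Type*} [AddCommMonoid M] (n : ℕ) (f : ℤ → ℤ → M) : M :=
  ∑ i ∈ Finset.Icc (1 : ℤ) (n : ℤ), ∑ j ∈ Finset.Icc (1 : ℤ) i, f i j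

/-- The index set `B_{ij}^a`: the pairs `(u, v)` that are at sup-distance at least `a` from `(i, j)`
and lie weakly before `(i, j)` in the lexicographic order of `ℤ × ℤ`. -/
def pastIndex (a : ℕ) (i j : ℤ) : Set (ℤ × ℤ) :=
  {p | (a : ℤ) ≤ max |p.1 - i| |p.2 - j| ∧ toLex p ≤ toLex (i, j)}

/-- The σ-field `F_{ij}^a` (for `j ≤ i`) generated by the variables `X_{uv}` with `(u, v) ∈ B_{ij}^a`
and `v ≤ u`. -/
@[reducible] def pastSigma {Ω : Type*} (X : ℤ × ℤ → Ω → ℝ) (a : ℕ) (i j : ℤ) : MeasurableSpace Ω :=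
  ⨆ p ∈ {p : ℤ × ℤ | p ∈ pastIndex a i j ∧ p.2 ≤ p.1},
    MeasurableSpace.comap (X p) (borel ℝ)

/-- The symmetric `n × n` matrix with entries `x i j` (`1 ≤ j ≤ i ≤ n`) on and below the diagonal,
divided by `√n`. The row index `k : Fin n` stands for the integer `k + 1`. -/
def scaledSymMatrix (n : ℕ) (x : ℕ+ → ℕ+ → ℝ) : Matrix (Fin n) (Fin n) ℝ :=
  Matrix.of fun i j =>
    (1 / Real.sqrt n) *
      (if j ≤ i then x (Nat.succPNat i) (Nat.succPNat j) else x (Nat.succPNat j) (Nat.succPNat i))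

theorem scaledSymMatrix_isHermitian (n : ℕ) (x : ℕ+ → ℕ+ → ℝ) :
    (scaledSymMatrix n x).IsHermitian := by
  ext i j
  simp only [Matrix.conjTranspose_apply, scaledSymMatrix, Matrix.of_apply, star_trivial]
  rcases lt_trichotomy i j with h | h | h
  · simp [h.le, not_le.mpr h]
  · simp [h]
  · simp [h.le, not_le.mpr h]

/-- The empirical spectral distribution of a Hermitian matrix, as a measure: mass `1 / n` at each of
the `n` eigenvalues, counted with multiplicity. -/
def empiricalSpectralMeasure {n : ℕ} {A : Matrix (Fin n) (Fin n) ℝ} (hA : A.IsHermitian) :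
    Measure ℝ :=
  (n : ℝ≥0∞)⁻¹ • ∑ k : Fin n, Measure.dirac (hA.eigenvalues k)

/-- The Stieltjes transform `z ↦ ∫ 1 / (x - z) dν(x)` of a measure on the line. -/
def stieltjesTransform (ν : Measure ℝ) (z : ℂ) : ℂ :=
  ∫ x, 1 / ((x : ℂ) - z) ∂ν

/-- The Stieltjes transform of the empirical spectral distribution of the symmetric matrix with
lower triangular entries `x i j / √n`. -/
def matrixStieltjes (n : ℕ) (x : ℕ+ → ℕ+ → ℝ) (z : ℂ) : ℂ :=
  stieltjesTransform (empiricalSpectralMeasure (scaledSymMatrix_isHermitian n x)) z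

/-- The index `(i, j)` of positive integers, as a point of `ℤ × ℤ`. -/
def toIntPair (p : ℕ+ × ℕ+) : ℤ × ℤ :=
  (((p.1 : ℕ) : ℤ), ((p.2 : ℕ) : ℤ))

end

end MartingaleMatrix

/-! The Stieltjes transform is the normalized trace of the resolvent, a smooth bounded function `s`
of the matrix entries. Lindeberg's method is applied not to `s` but to `(ℓ s - c) ^ 2`, where `ℓ` is
the real or imaginary part and `c` is the mean of `ℓ s` for the Gaussian matrix. For the Gaussian
matrix the expectation of this square is a variance, of order `1 / n` by Efron–Stein
(`integral_sq_sub_sq_integral_le_sum`). If the exchange changes the expectation by `o(1)`, then `ℓ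
s` for the dependent matrix is also close to `c` in `L²`. No separate concentration result for
dependent entries is needed, and Chebyshev's inequality concludes (`tendstoInMeasure_of_re_im`).

The exchange (`abs_integral_hybrid_sub_le`) introduces the entries of `X` in increasing
lexicographic order, so at step `a` every `X` entry already present lies in the past of `a`. Expand
to second order around the value `0` of entry `a` (`hasExpansion_sq`). The first order term in `X a`
vanishes by the martingale property, the one in the Gaussian entry by independence. In the second
order term, the entries of `X` within distance `b` of `a` are set to zero. The coefficient is then
measurable for the distant past once the Gaussian entries are frozen, and the conditional variance
hypothesis applies (`abs_integral_mul_sq_sub_le`). The price is a sum over a window of at most `(2 *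
b) ^ 2` neighbours.

Every error carries the factor `r ^ 4 = 1 / n ^ 2`, with `r = 1 / √n`, which compensates the
summation over the triangle. No third moments of `X` are available, so remainders have the form `t ^
2 * min 1 (r * |t|)`, and truncation at `ε √n` controls them through the Lindeberg condition. -/

namespace MartingaleMatrix

noncomputable section

/-! ### The matrix and its resolvent as functions of a configuration. -/

/-- The scaled symmetric matrix of a real configuration on `ℤ × ℤ`, with complex entries. -/
def complexMatrix (n : ℕ) (w : ℤ × ℤ → ℝ) : Matrix (Fin n) (Fin n) ℂ :=
  (scaledSymMatrix n fun i j => w (toIntPair (i, j))).map (fun x : ℝ => (x : ℂ))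

/-- The direction in which the complex matrix moves when the coordinate `k` moves. -/
def direction (n : ℕ) (k : ℤ × ℤ) : Matrix (Fin n) (Fin n) ℂ :=
  complexMatrix n (Pi.single k 1)

/-- The resolvent of the complex matrix. -/
def resolventMatrix (n : ℕ) (z : ℂ) (w : ℤ × ℤ → ℝ) : Matrix (Fin n) (Fin n) ℂ :=
  (complexMatrix n w - z • 1)⁻¹

/-- The normalized trace of the resolvent. -/
def traceResolvent (n : ℕ) (z : ℂ) (w : ℤ × ℤ → ℝ) : ℂ :=
  (n : ℂ)⁻¹ * (resolventMatrix n z w).trace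

theorem complexMatrix_update (n : ℕ) (w : ℤ × ℤ → ℝ) (k : ℤ × ℤ) (t : ℝ) :
    complexMatrix n (Function.update w k t)
      = complexMatrix n w + ((t - w k : ℝ) : ℂ) • direction n k := by
  ext i j
  simp only [complexMatrix, direction, scaledSymMatrix, Matrix.map_apply, Matrix.of_apply,
    Matrix.add_apply, Matrix.smul_apply, smul_eq_mul, Function.update_apply, Pi.single_apply]
  split_ifs <;> simp_all <;> ring

theorem complexMatrix_isHermitian (n : ℕ) (w : ℤ × ℤ → ℝ) : (complexMatrix n w).IsHermitian := by
  have h := scaledSymMatrix_isHermitian n fun i j => w (toIntPair (i, j))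
  ext i j
  have := congrFun (congrFun h i) j
  simp only [Matrix.conjTranspose_apply, star_trivial] at this
  simp [complexMatrix, this]

theorem complexMatrix_congr {n : ℕ} {w w' : ℤ × ℤ → ℝ}
    (h : ∀ p : ℤ × ℤ, 1 ≤ p.2 → p.2 ≤ p.1 → p.1 ≤ n → w p = w' p) :
    complexMatrix n w = complexMatrix n w' := by
  ext i j
  simp only [complexMatrix, scaledSymMatrix, Matrix.map_apply, Matrix.of_apply]
  congr 2
  split_ifs with hij
  · have := i.2
    apply h <;> simp only [toIntPair, Nat.succPNat_coe] <;> omega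
  · have := j.2
    apply h <;> simp only [toIntPair, Nat.succPNat_coe] <;> omega

/-- A coordinate outside the lower triangle does not enter the matrix. One inside fills a symmetric
pair of entries, or a single entry on the diagonal; the `if` prevents the diagonal from being
counted twice. -/
theorem direction_cases (n : ℕ) (k : ℤ × ℤ) :
    direction n k = 0 ∨ ∃ i j : Fin n,
      direction n k = ((1 / Real.sqrt n : ℝ) : ℂ) •
        (Matrix.single i j 1 + if i = j then 0 else Matrix.single j i 1) := by
  by_cases h : ∃ i j : Fin n, j ≤ i ∧ toIntPair (Nat.succPNat i, Nat.succPNat j) = k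
  · obtain ⟨i, j, hji, rfl⟩ := h
    refine Or.inr ⟨i, j, ?_⟩
    ext a b
    have key : ∀ a b c d : Fin n, toIntPair (Nat.succPNat a, Nat.succPNat b)
        = toIntPair (Nat.succPNat c, Nat.succPNat d) ↔ a = c ∧ b = d := by
      intro a b c d
      simp [toIntPair, Fin.ext_iff]
    simp only [direction, complexMatrix, scaledSymMatrix, Matrix.map_apply, Matrix.of_apply,
      Matrix.smul_apply, Matrix.add_apply, smul_eq_mul, Pi.single_apply, key]
    rw [Complex.ofReal_mul]
    congr 1
    by_cases hij : i = j
    · subst hij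
      simp only [Matrix.single_apply, if_true, Matrix.zero_apply, add_zero]
      have : (i = a ∧ i = b) ↔ (a = i ∧ b = i) := by grind
      simp only [this]
      split_ifs <;> first | rfl | (exfalso; grind)
    · have hlt : j < i := lt_of_le_of_ne hji (Ne.symm hij)
      rw [if_neg hij]
      simp only [Matrix.single_apply]
      split_ifs <;> first | (exfalso; grind) | simp
  · left
    push Not at h
    ext a b
    simp only [direction, complexMatrix, scaledSymMatrix, Matrix.map_apply, Matrix.of_apply,
      Matrix.zero_apply, Pi.single_apply]
    split_ifs with h1 h2 h2
    · exact absurd h2 (h a b h1)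
    · simp
    · exact absurd h2 (h b a (le_of_not_ge h1))
    · simp

/-! ### Operator norm bounds and the resolvent identity. -/

section Norms

open scoped Matrix.Norms.L2Operator

theorem norm_single_one_le {n : ℕ} (i j : Fin n) : ‖(Matrix.single i j 1 : Matrix (Fin n) (Fin n) ℂ)‖ ≤ 1 := by
  have h := CStarRing.norm_star_mul_self (x := (Matrix.single i j 1 : Matrix (Fin n) (Fin n) ℂ))
  have h2 : star (Matrix.single i j 1 : Matrix (Fin n) (Fin n) ℂ) * Matrix.single i j 1
      = Matrix.diagonal (Pi.single j 1) := by
    rw [Matrix.star_eq_conjTranspose, Matrix.conjTranspose_single, Matrix.single_mul_single_same,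
      Matrix.diagonal_single]
    simp
  rw [h2, Matrix.l2_opNorm_diagonal] at h
  have h3 : ‖(Pi.single j 1 : Fin n → ℂ)‖ ≤ 1 := by
    refine (pi_norm_le_iff_of_nonneg zero_le_one).2 fun a => ?_
    by_cases hh : a = j <;> simp [hh]
  nlinarith [norm_nonneg (Matrix.single i j 1 : Matrix (Fin n) (Fin n) ℂ)]

theorem norm_entry_le {n : ℕ} (B : Matrix (Fin n) (Fin n) ℂ) (i j : Fin n) : ‖B i j‖ ≤ ‖B‖ := by
  have h := B.l2_opNorm_mulVec (EuclideanSpace.single j (1 : ℂ))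
  have h2 := PiLp.norm_apply_le
    ((EuclideanSpace.equiv (Fin n) ℂ).symm (B.mulVec (EuclideanSpace.single j (1 : ℂ)).ofLp)) i
  have h3 : ((EuclideanSpace.equiv (Fin n) ℂ).symm
      (B.mulVec (EuclideanSpace.single j (1 : ℂ)).ofLp)) i = B i j := by
    simp
  rw [h3] at h2
  refine h2.trans (h.trans ?_)
  simp

theorem norm_direction_le (n : ℕ) (k : ℤ × ℤ) : ‖direction n k‖ ≤ 2 * (1 / Real.sqrt n) := by
  rcases direction_cases n k with h | ⟨i, j, h⟩
  · rw [h, norm_zero]; positivity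
  · rw [h, norm_smul, Complex.norm_real, Real.norm_of_nonneg (by positivity), mul_comm]
    gcongr
    refine (norm_add_le _ _).trans ?_
    have h1 := norm_single_one_le i j
    split_ifs
    · rw [norm_zero]; linarith
    · linarith [norm_single_one_le j i]

/-- The direction has at most two nonzero entries, so the trace reads off at most two entries of
`B`, and no factor `n` is lost. -/
theorem norm_trace_mul_direction_le {n : ℕ} (k : ℤ × ℤ) (B : Matrix (Fin n) (Fin n) ℂ) :
    ‖(B * direction n k).trace‖ ≤ 2 * (1 / Real.sqrt n) * ‖B‖ := by
  rcases direction_cases n k with h | ⟨i, j, h⟩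
  · rw [h]; simp; positivity
  · rw [h, Matrix.mul_smul, Matrix.trace_smul, norm_smul, Complex.norm_real,
      Real.norm_of_nonneg (by positivity), mul_comm (2 : ℝ), mul_assoc]
    gcongr
    rw [mul_add, Matrix.trace_add]
    refine (norm_add_le _ _).trans ?_
    have h1 : ∀ a b : Fin n, ‖(B * Matrix.single a b 1).trace‖ ≤ ‖B‖ := fun a b => by
      rw [Matrix.trace_mul_single]; simpa using norm_entry_le B b a
    split_ifs
    · rw [mul_zero, Matrix.trace_zero, norm_zero]; linarith [h1 i j, norm_nonneg B]
    · linarith [h1 i j, h1 j i]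

theorem norm_trace_le {n : ℕ} (B : Matrix (Fin n) (Fin n) ℂ) : ‖(n : ℂ)⁻¹ * B.trace‖ ≤ ‖B‖ := by
  rcases Nat.eq_zero_or_pos n with h | h
  · subst h; simp
  · rw [norm_mul, norm_inv, Complex.norm_natCast, inv_mul_le_iff₀ (by positivity)]
    refine (norm_sum_le _ _).trans ?_
    refine (Finset.sum_le_sum fun i _ => norm_entry_le B i i).trans ?_
    simp

/-- Since `⟨v, A v⟩` is real, the imaginary part of `⟨v, (A - z) v⟩` is `-Im z * ‖v‖ ^ 2`;
Cauchy–Schwarz does the rest. Invertibility of `A - z` and the resolvent bound both follow from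
this. -/
theorem im_mul_norm_le {n : ℕ} {A : Matrix (Fin n) (Fin n) ℂ} (hA : A.IsHermitian) {z : ℂ}
    (v : EuclideanSpace ℂ (Fin n)) :
    z.im * ‖v‖ ≤ ‖Matrix.toEuclideanCLM (𝕜 := ℂ) (A - z • 1) v‖ := by
  set T := Matrix.toEuclideanCLM (n := Fin n) (𝕜 := ℂ) A with hT
  have hsa : IsSelfAdjoint T := by
    rw [hT, IsSelfAdjoint, ← map_star, Matrix.star_eq_conjTranspose, hA]
  have h1 : Matrix.toEuclideanCLM (𝕜 := ℂ) (A - z • 1) v = T v - z • v := by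
    rw [map_sub, map_smul, map_one]; rfl
  rw [h1]
  have h2 : (inner ℂ v (T v - z • v)).im = - (z.im * ‖v‖ ^ 2) := by
    have h3 : (inner ℂ v (T v)).im = 0 := by
      have h4 := hsa.isSymmetric v v
      have h5 := inner_conj_symm (𝕜 := ℂ) v (T v)
      rw [ContinuousLinearMap.coe_coe] at h4
      rw [h4] at h5
      exact Complex.conj_eq_iff_im.1 h5
    have h6 : inner ℂ v v = ((‖v‖ ^ 2 : ℝ) : ℂ) := by
      rw [inner_self_eq_norm_sq_to_K]; simp
    rw [inner_sub_right, inner_smul_right, Complex.sub_im, h3, h6, Complex.im_mul_ofReal]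
    ring
  rcases eq_or_ne v 0 with rfl | hv
  · simp
  have h3 := (Complex.abs_im_le_norm _).trans (norm_inner_le_norm (𝕜 := ℂ) v (T v - z • v))
  rw [h2, abs_neg] at h3
  have hv' : 0 < ‖v‖ := norm_pos_iff.2 hv
  have h4 := (le_abs_self _).trans h3
  nlinarith

theorem isUnit_sub_smul_one {n : ℕ} {A : Matrix (Fin n) (Fin n) ℂ} (hA : A.IsHermitian) {z : ℂ}
    (hz : 0 < z.im) : IsUnit (A - z • 1) := by
  rw [← Matrix.mulVec_injective_iff_isUnit]
  intro x y hxy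
  have h := im_mul_norm_le hA (z := z) (WithLp.toLp 2 (x - y))
  rw [Matrix.toEuclideanCLM_toLp, Matrix.mulVec_sub, hxy, sub_self] at h
  have h0 : ‖WithLp.toLp 2 (x - y)‖ ≤ 0 := by
    have : ‖(WithLp.toLp 2 (0 : Fin n → ℂ))‖ = 0 := by simp
    rw [this] at h
    by_contra! hh
    nlinarith
  have h1 := norm_le_zero_iff.1 h0
  have h2 : x - y = 0 := congrArg WithLp.ofLp h1
  exact sub_eq_zero.1 h2

theorem norm_inv_sub_smul_one_le {n : ℕ} {A : Matrix (Fin n) (Fin n) ℂ} (hA : A.IsHermitian)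
    {z : ℂ} (hz : 0 < z.im) : ‖(A - z • 1)⁻¹‖ ≤ 1 / z.im := by
  rw [Matrix.cstar_norm_def]
  refine ContinuousLinearMap.opNorm_le_bound _ (by positivity) fun v => ?_
  have h := im_mul_norm_le hA (z := z) (Matrix.toEuclideanCLM (𝕜 := ℂ) ((A - z • 1)⁻¹) v)
  rw [← mul_apply_eq_comp, ← map_mul,
    Matrix.mul_nonsing_inv _ ((Matrix.isUnit_iff_isUnit_det _).1 (isUnit_sub_smul_one hA hz)),
    map_one, one_apply_eq_self] at h
  rw [one_div, inv_mul_eq_div, le_div_iff₀ hz]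
  linarith

theorem resolventMatrix_sub {n : ℕ} {z : ℂ} (hz : 0 < z.im) (w w' : ℤ × ℤ → ℝ) :
    resolventMatrix n z w' - resolventMatrix n z w
      = resolventMatrix n z w' * (complexMatrix n w - complexMatrix n w') * resolventMatrix n z w := by
  have h := fun w => isUnit_sub_smul_one (complexMatrix_isHermitian n w) hz
  have h1 := Matrix.mul_nonsing_inv _ ((Matrix.isUnit_iff_isUnit_det _).1 (h w))
  have h2 := Matrix.nonsing_inv_mul _ ((Matrix.isUnit_iff_isUnit_det _).1 (h w'))
  have h3 : complexMatrix n w - complexMatrix n w'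
      = (complexMatrix n w - z • 1) - (complexMatrix n w' - z • 1) := by abel
  rw [h3, mul_sub, sub_mul, mul_assoc]
  unfold resolventMatrix
  rw [h1, h2, mul_one, one_mul]

theorem resolventMatrix_update_sub {n : ℕ} {z : ℂ} (hz : 0 < z.im) (w : ℤ × ℤ → ℝ) (k : ℤ × ℤ)
    (t : ℝ) :
    resolventMatrix n z (Function.update w k t) - resolventMatrix n z w
      = ((w k - t : ℝ) : ℂ) •
        (resolventMatrix n z (Function.update w k t) * direction n k * resolventMatrix n z w) := by
  rw [resolventMatrix_sub hz, complexMatrix_update, sub_add_cancel_left, ← neg_smul,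
    mul_smul_comm, smul_mul_assoc]
  congr 1
  push_cast; ring

end Norms

/-! ### Continuity of the resolvent and its link to the spectral measure. -/

theorem continuous_complexMatrix (n : ℕ) : Continuous (complexMatrix n) := by
  refine continuous_matrix fun i j => ?_
  simp only [complexMatrix, scaledSymMatrix, Matrix.map_apply, Matrix.of_apply]
  split_ifs <;> fun_prop

theorem continuous_resolventMatrix (n : ℕ) {z : ℂ} (hz : 0 < z.im) :
    Continuous (resolventMatrix n z) := by
  have h := fun w => isUnit_sub_smul_one (complexMatrix_isHermitian n w) hz
  have hc : Continuous fun w => complexMatrix n w - z • (1 : Matrix (Fin n) (Fin n) ℂ) :=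
    (continuous_complexMatrix n).sub continuous_const
  unfold resolventMatrix
  simp_rw [Matrix.inv_def, Ring.inverse_eq_inv']
  refine Continuous.smul (hc.matrix_det.inv₀ fun w => ?_) hc.matrix_adjugate
  exact ((Matrix.isUnit_iff_isUnit_det _).1 (h w)).ne_zero

/-- An orthogonal diagonalization of the real matrix, cast entrywise to `ℂ`, also diagonalizes the
resolvent, and the trace is invariant under conjugation. -/
theorem matrixStieltjes_eq_traceResolvent {n : ℕ} {z : ℂ} (hz : 0 < z.im) (w : ℤ × ℤ → ℝ) :
    matrixStieltjes n (fun i j => w (toIntPair (i, j))) z = traceResolvent n z w := by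
  rcases Nat.eq_zero_or_pos n with hn | hn
  · subst hn
    simp [matrixStieltjes, traceResolvent, stieltjesTransform, empiricalSpectralMeasure]
  set A := scaledSymMatrix n fun i j => w (toIntPair (i, j)) with hAdef
  have hA : A.IsHermitian := scaledSymMatrix_isHermitian n _
  have h1 : matrixStieltjes n (fun i j => w (toIntPair (i, j))) z
      = (n : ℂ)⁻¹ * ∑ k, 1 / ((hA.eigenvalues k : ℂ) - z) := by
    unfold matrixStieltjes stieltjesTransform empiricalSpectralMeasure
    rw [integral_smul_measure, integral_finsetSum_measure]
    · simp
    · intro i _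
      exact integrable_dirac (by simp)
  have hne : ∀ k, (hA.eigenvalues k : ℂ) - z ≠ 0 := fun k h => by
    have := congrArg Complex.im h
    simp at this
    linarith
  rw [h1, traceResolvent]
  congr 1
  have hs := hA.spectral_theorem
  rw [Unitary.conjStarAlgAut_apply] at hs
  set U : Matrix (Fin n) (Fin n) ℝ := (hA.eigenvectorUnitary : Matrix (Fin n) (Fin n) ℝ) with hU
  have hUU : U * star U = 1 := Unitary.mul_star_self_of_mem hA.eigenvectorUnitary.2
  have hUU' : star U * U = 1 := Unitary.star_mul_self_of_mem hA.eigenvectorUnitary.2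
  let V := U.map (fun x : ℝ => (x : ℂ))
  let V' := (star U).map (fun x : ℝ => (x : ℂ))
  have hmap : ∀ P Q : Matrix (Fin n) (Fin n) ℝ, (P * Q).map (fun x : ℝ => (x : ℂ))
      = P.map (fun x : ℝ => (x : ℂ)) * Q.map (fun x : ℝ => (x : ℂ)) := fun P Q => by
    ext i j; simp [Matrix.mul_apply]
  have hone : (1 : Matrix (Fin n) (Fin n) ℝ).map (fun x : ℝ => (x : ℂ)) = 1 := by
    ext i j; by_cases h : i = j <;> simp [Matrix.one_apply, h]
  have hV : V * V' = 1 := by rw [← hmap, hUU, hone]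
  have hV' : V' * V = 1 := by rw [← hmap, hUU', hone]
  have hM : complexMatrix n w - z • 1
      = V * Matrix.diagonal (fun k => (hA.eigenvalues k : ℂ) - z) * V' := by
    have h2 : Matrix.diagonal (fun k => (hA.eigenvalues k : ℂ) - z)
        = (Matrix.diagonal hA.eigenvalues).map (fun x : ℝ => (x : ℂ)) - z • 1 := by
      ext i j; by_cases h : i = j <;> simp [h]
    rw [h2, mul_sub, sub_mul, mul_smul_comm, smul_mul_assoc, mul_one, hV, ← hmap, ← hmap]
    congr 1
    exact congrArg (fun P : Matrix (Fin n) (Fin n) ℝ => P.map (fun x : ℝ => (x : ℂ))) hs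
  have hinv : resolventMatrix n z w
      = V * Matrix.diagonal (fun k => 1 / ((hA.eigenvalues k : ℂ) - z)) * V' := by
    refine Matrix.inv_eq_right_inv ?_
    rw [hM]
    calc _ = V * (Matrix.diagonal (fun k => (hA.eigenvalues k : ℂ) - z) * (V' * V) *
        Matrix.diagonal (fun k => 1 / ((hA.eigenvalues k : ℂ) - z))) * V' := by
          simp only [mul_assoc]
      _ = 1 := by
        rw [hV', mul_one, Matrix.diagonal_mul_diagonal]
        have : (fun k => ((hA.eigenvalues k : ℂ) - z) * (1 / ((hA.eigenvalues k : ℂ) - z)))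
          = fun _ => 1 := by
            funext k; exact mul_one_div_cancel (hne k)
        rw [this, Matrix.diagonal_one, mul_one, hV]
  rw [hinv, Matrix.trace_mul_comm, ← mul_assoc, hV', one_mul, Matrix.trace_diagonal]

/-! ### Taylor expansion in a single entry. -/

/-- Minus the first derivative of the normalized trace of the resolvent in the coordinate `k`. -/
def traceDeriv (n : ℕ) (z : ℂ) (k : ℤ × ℤ) (w : ℤ × ℤ → ℝ) : ℂ :=
  (n : ℂ)⁻¹ * (resolventMatrix n z w * direction n k * resolventMatrix n z w).trace

/-- Half the second derivative of the normalized trace of the resolvent in the coordinate `k`. -/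
def traceDerivTwo (n : ℕ) (z : ℂ) (k : ℤ × ℤ) (w : ℤ × ℤ → ℝ) : ℂ :=
  (n : ℂ)⁻¹ * (resolventMatrix n z w * direction n k * resolventMatrix n z w * direction n k *
    resolventMatrix n z w).trace

/-- A real function of a configuration which is bounded, has quantitative second order Taylor
expansions at `0` in each coordinate, and whose second order coefficients are Lipschitz in each
coordinate. The scale `r` stands for `1 / √n`. -/
structure HasExpansion (r C : ℝ) (φ : (ℤ × ℤ → ℝ) → ℝ) (d₁ d₂ : ℤ × ℤ → (ℤ × ℤ → ℝ) → ℝ) :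
    Prop where
  measurable : Measurable φ
  measurable₁ : ∀ k, Measurable (d₁ k)
  measurable₂ : ∀ k, Measurable (d₂ k)
  bound : ∀ w, |φ w| ≤ C
  -- No power of `r` is required here: first order terms integrate exactly to zero, and the bound
  -- only serves integrability. The second order data need `r ^ 4`, to be summed over about `n ^ 2`
  -- entries.
  bound₁ : ∀ k w, |d₁ k w| ≤ C
  bound₂ : ∀ k w, |d₂ k w| ≤ C * r ^ 4
  taylor : ∀ k w t, |φ (Function.update w k t) - φ (Function.update w k 0)
    - d₁ k (Function.update w k 0) * t - d₂ k (Function.update w k 0) * t ^ 2|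
      ≤ C * r ^ 4 * (t ^ 2 * min 1 (r * |t|))
  lipschitz₂ : ∀ k l w, |d₂ k w - d₂ k (Function.update w l 0)| ≤ C * r ^ 4 * min 1 (r * |w l|)

section Norms

open scoped Matrix.Norms.L2Operator

variable {n : ℕ} {z : ℂ} {K : ℝ}

theorem norm_resolventMatrix_le (hz : 0 < z.im) (hK : 1 / z.im ≤ K) (w : ℤ × ℤ → ℝ) :
    ‖resolventMatrix n z w‖ ≤ K :=
  (norm_inv_sub_smul_one_le (complexMatrix_isHermitian n w) hz).trans hK

theorem norm_normalized_trace_direction_le (hn : n ≠ 0) (k : ℤ × ℤ)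
    (B : Matrix (Fin n) (Fin n) ℂ) :
    ‖(n : ℂ)⁻¹ * (B * direction n k).trace‖ ≤ 2 * (1 / Real.sqrt n) ^ 3 * ‖B‖ := by
  have h : ((n : ℝ))⁻¹ = (1 / Real.sqrt n) ^ 2 := by
    rw [div_pow, Real.sq_sqrt (by positivity), one_pow, one_div]
  rw [norm_mul, norm_inv, Complex.norm_natCast, h]
  calc _ ≤ (1 / Real.sqrt n) ^ 2 * (2 * (1 / Real.sqrt n) * ‖B‖) := by
        gcongr; exact norm_trace_mul_direction_le k B
    _ = _ := by ring

theorem norm_mul_le_of_le' {A B : Matrix (Fin n) (Fin n) ℂ} {a b : ℝ} (ha : ‖A‖ ≤ a) (hb : ‖B‖ ≤ b) :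
    ‖A * B‖ ≤ a * b :=
  (norm_mul_le A B).trans (mul_le_mul ha hb (norm_nonneg _) ((norm_nonneg _).trans ha))

theorem norm_resolventMatrix_sub_le (hz : 0 < z.im) (hK : 1 / z.im ≤ K) (hK1 : 1 ≤ K)
    (w : ℤ × ℤ → ℝ) (l : ℤ × ℤ) :
    ‖resolventMatrix n z (Function.update w l 0) - resolventMatrix n z w‖
      ≤ 2 * K ^ 2 * min 1 (1 / Real.sqrt n * |w l|) := by
  have hG := norm_resolventMatrix_le (n := n) hz hK
  rcases min_cases 1 (1 / Real.sqrt n * |w l|) with ⟨h, _⟩ | ⟨h, _⟩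
  · rw [h]
    refine (norm_sub_le _ _).trans ?_
    nlinarith [hG w, hG (Function.update w l 0)]
  · rw [h, resolventMatrix_update_sub hz, norm_smul, Complex.norm_real, sub_zero, Real.norm_eq_abs]
    calc _ ≤ |w l| * (K * (2 * (1 / Real.sqrt n)) * K) := by
          gcongr
          exact norm_mul_le_of_le' (norm_mul_le_of_le' (hG _) (norm_direction_le n l)) (hG _)
      _ = _ := by ring

theorem norm_traceResolvent_le (hz : 0 < z.im) (hK : 1 / z.im ≤ K) (w : ℤ × ℤ → ℝ) :
    ‖traceResolvent n z w‖ ≤ K :=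
  (norm_trace_le _).trans (norm_resolventMatrix_le hz hK w)

theorem norm_traceDeriv_le (hn : n ≠ 0) (hz : 0 < z.im) (hK : 1 / z.im ≤ K) (k : ℤ × ℤ)
    (w : ℤ × ℤ → ℝ) : ‖traceDeriv n z k w‖ ≤ 2 * K ^ 2 * (1 / Real.sqrt n) ^ 3 := by
  have hG := norm_resolventMatrix_le (n := n) hz hK
  rw [traceDeriv, Matrix.trace_mul_comm, ← mul_assoc]
  refine (norm_normalized_trace_direction_le hn k _).trans ?_
  calc _ ≤ 2 * (1 / Real.sqrt n) ^ 3 * (K * K) := by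
        gcongr; exact norm_mul_le_of_le' (hG _) (hG _)
    _ = _ := by ring

theorem norm_traceDerivTwo_le (hn : n ≠ 0) (hz : 0 < z.im) (hK : 1 / z.im ≤ K) (k : ℤ × ℤ)
    (w : ℤ × ℤ → ℝ) : ‖traceDerivTwo n z k w‖ ≤ 4 * K ^ 3 * (1 / Real.sqrt n) ^ 4 := by
  have hG := norm_resolventMatrix_le (n := n) hz hK
  rw [traceDerivTwo, Matrix.trace_mul_comm, ← mul_assoc]
  refine (norm_normalized_trace_direction_le hn k _).trans ?_
  calc _ ≤ 2 * (1 / Real.sqrt n) ^ 3 * (K * (K * (2 * (1 / Real.sqrt n)) * K)) := by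
        gcongr
        exact norm_mul_le_of_le' (hG _)
          (norm_mul_le_of_le' (norm_mul_le_of_le' (hG _) (norm_direction_le n k)) (hG _))
    _ = _ := by ring

theorem resolventMatrix_update_eq (hz : 0 < z.im) (k : ℤ × ℤ) (w : ℤ × ℤ → ℝ) (t : ℝ) :
    resolventMatrix n z (Function.update w k t) - resolventMatrix n z (Function.update w k 0)
      = -((t : ℂ) • (resolventMatrix n z (Function.update w k t) * direction n k *
        resolventMatrix n z (Function.update w k 0))) := by
  have h := resolventMatrix_update_sub (n := n) hz (Function.update w k 0) k t
  rw [Function.update_idem, Function.update_self] at h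
  rw [h, ← neg_smul]
  push_cast
  rw [zero_sub]

theorem norm_traceResolvent_update_sub_le (hn : n ≠ 0) (hz : 0 < z.im) (hK : 1 / z.im ≤ K)
    (k : ℤ × ℤ) (w : ℤ × ℤ → ℝ) (t : ℝ) :
    ‖traceResolvent n z (Function.update w k t) - traceResolvent n z (Function.update w k 0)‖
      ≤ 2 * K ^ 2 * (1 / Real.sqrt n) ^ 3 * |t| := by
  have hG := norm_resolventMatrix_le (n := n) hz hK
  rw [traceResolvent, traceResolvent, ← mul_sub, ← Matrix.trace_sub, resolventMatrix_update_eq hz,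
    Matrix.trace_neg, Matrix.trace_smul, Matrix.trace_mul_comm, ← mul_assoc, smul_eq_mul, mul_neg,
    norm_neg, mul_left_comm, norm_mul, Complex.norm_real, Real.norm_eq_abs, mul_comm]
  gcongr
  refine (norm_normalized_trace_direction_le hn k _).trans ?_
  calc _ ≤ 2 * (1 / Real.sqrt n) ^ 3 * (K * K) := by
        gcongr; exact norm_mul_le_of_le' (hG _) (hG _)
    _ = _ := by ring

/-- Iterating the resolvent identity leaves an exact remainder `t ^ 2 • (G * U * H * U * H)`.
Cyclicity of the trace moves one `U` to the end, where it yields `r ^ 3`; the other `U` contributes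
one more `r` through its norm. -/
theorem norm_traceResolvent_taylor_one_le (hn : n ≠ 0) (hz : 0 < z.im) (hK : 1 / z.im ≤ K)
    (k : ℤ × ℤ) (w : ℤ × ℤ → ℝ) (t : ℝ) :
    ‖traceResolvent n z (Function.update w k t) - traceResolvent n z (Function.update w k 0)
      + t * traceDeriv n z k (Function.update w k 0)‖
      ≤ 4 * K ^ 3 * (1 / Real.sqrt n) ^ 4 * |t| ^ 2 := by
  have hG := norm_resolventMatrix_le (n := n) hz hK
  have key := resolventMatrix_update_eq (n := n) hz k w t
  set G := resolventMatrix n z (Function.update w k t)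
  set H := resolventMatrix n z (Function.update w k 0)
  set U := direction n k
  have h1 : (G - H) + (t : ℂ) • (H * U * H) = ((t : ℂ) ^ 2) • (G * U * H * U * H) := by
    have : G * U * H - H * U * H = -((t : ℂ) • (G * U * H * U * H)) := by
      rw [← sub_mul, ← sub_mul, key]; simp only [neg_mul, smul_mul_assoc]
    rw [sub_eq_iff_eq_add] at this
    generalize G * U * H * U * H = Y at this ⊢
    rw [key, this]
    module
  rw [traceResolvent, traceResolvent, traceDeriv, mul_left_comm, ← smul_eq_mul (t : ℂ),
    ← Matrix.trace_smul, ← mul_sub, ← Matrix.trace_sub, ← mul_add, ← Matrix.trace_add, h1,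
    Matrix.trace_smul, Matrix.trace_mul_comm, ← mul_assoc, smul_eq_mul, mul_left_comm, norm_mul,
    norm_pow, Complex.norm_real, Real.norm_eq_abs, mul_comm]
  gcongr
  refine (norm_normalized_trace_direction_le hn k _).trans ?_
  calc _ ≤ 2 * (1 / Real.sqrt n) ^ 3 * (K * (K * (2 * (1 / Real.sqrt n)) * K)) := by
        gcongr
        exact norm_mul_le_of_le' (hG _)
          (norm_mul_le_of_le' (norm_mul_le_of_le' (hG _) (norm_direction_le n k)) (hG _))
    _ = _ := by ring

theorem norm_traceResolvent_taylor_two_le (hn : n ≠ 0) (hz : 0 < z.im) (hK : 1 / z.im ≤ K)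
    (k : ℤ × ℤ) (w : ℤ × ℤ → ℝ) (t : ℝ) :
    ‖traceResolvent n z (Function.update w k t) - traceResolvent n z (Function.update w k 0)
      + t * traceDeriv n z k (Function.update w k 0)
      - t ^ 2 * traceDerivTwo n z k (Function.update w k 0)‖
      ≤ 8 * K ^ 4 * (1 / Real.sqrt n) ^ 5 * |t| ^ 3 := by
  have hG := norm_resolventMatrix_le (n := n) hz hK
  have key := resolventMatrix_update_eq (n := n) hz k w t
  set G := resolventMatrix n z (Function.update w k t)
  set H := resolventMatrix n z (Function.update w k 0)
  set U := direction n k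
  have h1 : (G - H) + (t : ℂ) • (H * U * H) - ((t : ℂ) ^ 2) • (H * U * H * U * H)
      = -(((t : ℂ) ^ 3) • (G * U * H * U * H * U * H)) := by
    have a : G * U * H - H * U * H = -((t : ℂ) • (G * U * H * U * H)) := by
      rw [← sub_mul, ← sub_mul, key]; simp only [neg_mul, smul_mul_assoc]
    have b : G * U * H * U * H - H * U * H * U * H = -((t : ℂ) • (G * U * H * U * H * U * H)) := by
      rw [← sub_mul, ← sub_mul, ← sub_mul, ← sub_mul, key]; simp only [neg_mul, smul_mul_assoc]
    rw [sub_eq_iff_eq_add] at a b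
    generalize G * U * H * U * H * U * H = Z at b ⊢
    generalize G * U * H * U * H = Y at a b
    rw [key, a, b]
    module
  rw [traceResolvent, traceResolvent, traceDeriv, traceDerivTwo, mul_left_comm,
    mul_left_comm ((t : ℂ) ^ 2), ← smul_eq_mul (t : ℂ), ← smul_eq_mul ((t : ℂ) ^ 2),
    ← Matrix.trace_smul, ← Matrix.trace_smul, ← mul_sub, ← Matrix.trace_sub, ← mul_add,
    ← Matrix.trace_add, ← mul_sub, ← Matrix.trace_sub, h1, Matrix.trace_neg,
    Matrix.trace_smul, Matrix.trace_mul_comm, ← mul_assoc, smul_eq_mul, mul_neg, norm_neg,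
    mul_left_comm, norm_mul, norm_pow, Complex.norm_real, Real.norm_eq_abs, mul_comm]
  gcongr
  refine (norm_normalized_trace_direction_le hn k _).trans ?_
  calc _ ≤ 2 * (1 / Real.sqrt n) ^ 3 * (K * (K * (2 * (1 / Real.sqrt n)) * K *
        (2 * (1 / Real.sqrt n)) * K)) := by
        have hU := norm_direction_le n k
        gcongr
        exact norm_mul_le_of_le' (hG _)
          (norm_mul_le_of_le' (norm_mul_le_of_le' (norm_mul_le_of_le' (norm_mul_le_of_le' (hG _)
            hU) (hG _)) hU) (hG _))
    _ = _ := by ring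

theorem norm_mul_sub_mul_le {A B A' B' : Matrix (Fin n) (Fin n) ℂ} {a b d e : ℝ} (ha : ‖A'‖ ≤ a)
    (hb : ‖B‖ ≤ b) (hd : ‖A' - A‖ ≤ d) (he : ‖B' - B‖ ≤ e) :
    ‖A' * B' - A * B‖ ≤ a * e + d * b := by
  have : A' * B' - A * B = A' * (B' - B) + (A' - A) * B := by noncomm_ring
  rw [this]
  exact (norm_add_le _ _).trans (add_le_add (norm_mul_le_of_le' ha he) (norm_mul_le_of_le' hd hb))

theorem norm_traceDeriv_sub_le (hn : n ≠ 0) (hz : 0 < z.im) (hK : 1 / z.im ≤ K) (hK1 : 1 ≤ K)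
    (k l : ℤ × ℤ) (w : ℤ × ℤ → ℝ) :
    ‖traceDeriv n z k (Function.update w l 0) - traceDeriv n z k w‖
      ≤ 8 * K ^ 3 * (1 / Real.sqrt n) ^ 3 * min 1 (1 / Real.sqrt n * |w l|) := by
  have hG := norm_resolventMatrix_le (n := n) hz hK
  have hd := norm_resolventMatrix_sub_le (n := n) hz hK hK1 w l
  rw [traceDeriv, traceDeriv, Matrix.trace_mul_comm, ← mul_assoc,
    Matrix.trace_mul_comm (resolventMatrix n z w * _), ← mul_assoc, ← mul_sub, ← Matrix.trace_sub,
    ← sub_mul]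
  refine (norm_normalized_trace_direction_le hn k _).trans ?_
  calc _ ≤ 2 * (1 / Real.sqrt n) ^ 3 * _ :=
        mul_le_mul_of_nonneg_left (norm_mul_sub_mul_le (hG _) (hG _) hd hd) (by positivity)
    _ = _ := by ring

theorem norm_traceDerivTwo_sub_le (hn : n ≠ 0) (hz : 0 < z.im) (hK : 1 / z.im ≤ K) (hK1 : 1 ≤ K)
    (k l : ℤ × ℤ) (w : ℤ × ℤ → ℝ) :
    ‖traceDerivTwo n z k (Function.update w l 0) - traceDerivTwo n z k w‖
      ≤ 24 * K ^ 4 * (1 / Real.sqrt n) ^ 4 * min 1 (1 / Real.sqrt n * |w l|) := by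
  have hG := norm_resolventMatrix_le (n := n) hz hK
  have hd := norm_resolventMatrix_sub_le (n := n) hz hK hK1 w l
  have hU := norm_direction_le n k
  have hU0 : ‖direction n k - direction n k‖ ≤ 0 := by simp
  rw [traceDerivTwo, traceDerivTwo, Matrix.trace_mul_comm,
    Matrix.trace_mul_comm (resolventMatrix n z w * _ * _ * _),
    ← mul_assoc (resolventMatrix n z w) (_ * _ * _) _,
    ← mul_assoc (resolventMatrix n z _) (_ * _ * _) _, ← mul_sub,
    ← Matrix.trace_sub, ← sub_mul]
  refine (norm_normalized_trace_direction_le hn k _).trans ?_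
  calc _ ≤ 2 * (1 / Real.sqrt n) ^ 3 * _ :=
        mul_le_mul_of_nonneg_left (norm_mul_sub_mul_le (hG _)
          (norm_mul_le_of_le' (norm_mul_le_of_le' (hG _) hU) (hG _)) hd
          (norm_mul_sub_mul_le (norm_mul_le_of_le' (hG _) hU) (hG _)
            (norm_mul_sub_mul_le (hG _) hU hd hU0) hd)) (by positivity)
    _ = _ := by ring

theorem norm_traceResolvent_sub_le (hz : 0 < z.im) (hK : 1 / z.im ≤ K) (hK1 : 1 ≤ K)
    (l : ℤ × ℤ) (w : ℤ × ℤ → ℝ) :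
    ‖traceResolvent n z (Function.update w l 0) - traceResolvent n z w‖
      ≤ 2 * K ^ 2 * min 1 (1 / Real.sqrt n * |w l|) := by
  rw [traceResolvent, traceResolvent, ← mul_sub, ← Matrix.trace_sub]
  exact (norm_trace_le _).trans (norm_resolventMatrix_sub_le hz hK hK1 w l)

end Norms

/-- Passage from an expansion of `R` to one of `(u + R) ^ 2`. For `τ ≤ 1` the remainder bound of
highest order is used, for `τ ≥ 1` the lower one; this produces `min 1 τ`. It is applied with `b = r
^ 2` and `τ = r * |t|`. -/
theorem abs_sq_taylor_le {A b τ u p q R : ℝ} (hb : 0 ≤ b) (hb1 : b ≤ 1) (hA : 1 ≤ A) (hτ : 0 ≤ τ)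
    (hu : |u| ≤ A) (hp : |p| ≤ A * b * τ) (hq : |q| ≤ A * b * τ ^ 2)
    (h3 : |R - p - q| ≤ A * b * τ ^ 3)
    (h2 : |R - p| ≤ A * b * τ ^ 2) (h1 : |R| ≤ A * b * τ) :
    |(u + R) ^ 2 - u ^ 2 - 2 * u * p - (p ^ 2 + 2 * u * q)| ≤ 12 * A ^ 2 * b * (τ ^ 2 * min 1 τ) := by
  have hm0 : 0 ≤ min 1 τ := le_min zero_le_one hτ
  have hmul : τ ^ 3 ≤ τ ^ 2 ∧ min 1 τ = τ ∨ τ ^ 2 ≤ τ ^ 3 ∧ τ ≤ τ ^ 2 ∧ min 1 τ = 1 := by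
    rcases le_total τ 1 with h | h
    · left; exact ⟨by nlinarith [sq_nonneg τ], min_eq_right h⟩
    · right; exact ⟨by nlinarith [sq_nonneg τ], by nlinarith, min_eq_left h⟩
  have hAb : 0 ≤ A * b := by positivity
  have e3 : |R - p - q| ≤ 2 * (A * b) * (τ ^ 2 * min 1 τ) := by
    rcases hmul with ⟨_, h⟩ | ⟨_, _, h⟩
    · rw [h]; refine h3.trans ?_
      nlinarith [pow_nonneg hτ 3, mul_nonneg hAb (pow_nonneg hτ 3)]
    · rw [h]; refine (abs_sub _ _).trans ?_; linarith
  have e2 : |R - p| ≤ 2 * (A * b) * (τ * min 1 τ) := by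
    rcases hmul with ⟨_, h⟩ | ⟨_, _, h⟩
    · rw [h]; refine h2.trans ?_
      nlinarith [mul_nonneg hAb (pow_nonneg hτ 2)]
    · rw [h]; refine (abs_sub _ _).trans ?_; linarith
  have e1 : |R - p| ≤ 2 * (A * b) * τ := (abs_sub _ _).trans (by linarith)
  have heq : (u + R) ^ 2 - u ^ 2 - 2 * u * p - (p ^ 2 + 2 * u * q)
      = 2 * (u * (R - p - q)) + 2 * (p * (R - p)) + (R - p) * (R - p) := by ring
  rw [heq]
  refine (abs_add_three _ _ _).trans ?_
  rw [abs_mul, abs_mul, abs_mul 2, abs_mul p, abs_mul (R - p), abs_two]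
  have f1 : |u| * |R - p - q| ≤ A * (2 * (A * b) * (τ ^ 2 * min 1 τ)) := by gcongr
  have f2 : |p| * |R - p| ≤ (A * b * τ) * (2 * (A * b) * (τ * min 1 τ)) := by gcongr
  have f3 : |R - p| * |R - p| ≤ (2 * (A * b) * τ) * (2 * (A * b) * (τ * min 1 τ)) := by gcongr
  have f4 : A ^ 2 * b ^ 2 * (τ ^ 2 * min 1 τ) ≤ A ^ 2 * b * (τ ^ 2 * min 1 τ) := by
    gcongr; nlinarith
  nlinarith

theorem hasExpansion_sq {n : ℕ} (hn : n ≠ 0) {z : ℂ} (hz : 0 < z.im) {K : ℝ} (hK : 1 / z.im ≤ K)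
    (hK1 : 1 ≤ K) (ℓ : ℂ →L[ℝ] ℝ) (hℓ : ∀ x, |ℓ x| ≤ ‖x‖) {c : ℝ} (hc : |c| ≤ K) :
    HasExpansion (1 / Real.sqrt n) (12 * (8 * K ^ 4) ^ 2)
      (fun w => (ℓ (traceResolvent n z w) - c) ^ 2)
      (fun k w => -(2 * (ℓ (traceResolvent n z w) - c) * ℓ (traceDeriv n z k w)))
      (fun k w => ℓ (traceDeriv n z k w) ^ 2
        + 2 * (ℓ (traceResolvent n z w) - c) * ℓ (traceDerivTwo n z k w)) := by
  have hG := continuous_resolventMatrix n hz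
  have hs : Continuous (traceResolvent n z) := continuous_const.mul hG.matrix_trace
  have hs1 : ∀ k, Continuous (traceDeriv n z k) := fun k =>
    continuous_const.mul ((hG.matrix_mul continuous_const).matrix_mul hG).matrix_trace
  have hs2 : ∀ k, Continuous (traceDerivTwo n z k) := fun k =>
    continuous_const.mul ((((hG.matrix_mul continuous_const).matrix_mul hG).matrix_mul
      continuous_const).matrix_mul hG).matrix_trace
  set r := 1 / Real.sqrt n with hr
  have hr0 : 0 ≤ r := by positivity
  have hr1 : r ≤ 1 := by
    rw [hr, div_le_one (by positivity)]
    exact Real.one_le_sqrt.2 (by exact_mod_cast Nat.one_le_iff_ne_zero.2 hn)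
  -- The largest constant among the Taylor bounds, that of the third order remainder; as `K ≥ 1` it
  -- dominates the others.
  set A := 8 * K ^ 4 with hA
  have k1 : K ≤ K ^ 4 := le_self_pow₀ hK1 (by norm_num)
  have k2 : K ^ 2 ≤ K ^ 4 := pow_le_pow_right₀ hK1 (by norm_num)
  have k3 : K ^ 3 ≤ K ^ 4 := pow_le_pow_right₀ hK1 (by norm_num)
  have hA1 : 1 ≤ A := by linarith
  have hu : ∀ w, |ℓ (traceResolvent n z w) - c| ≤ A := fun w => by
    refine (abs_sub _ _).trans ?_
    have := (hℓ _).trans (norm_traceResolvent_le (n := n) hz hK w)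
    linarith
  have hp : ∀ k w, |ℓ (traceDeriv n z k w)| ≤ A * r ^ 3 := fun k w =>
    ((hℓ _).trans (norm_traceDeriv_le hn hz hK k w)).trans (by gcongr; linarith)
  have hq : ∀ k w, |ℓ (traceDerivTwo n z k w)| ≤ A * r ^ 4 := fun k w =>
    ((hℓ _).trans (norm_traceDerivTwo_le hn hz hK k w)).trans (by gcongr; linarith)
  have r3 : r ^ 3 ≤ 1 := pow_le_one₀ hr0 hr1
  have r4 : r ^ 4 ≤ 1 := pow_le_one₀ hr0 hr1
  have r64 : r ^ 6 ≤ r ^ 4 := pow_le_pow_of_le_one hr0 hr1 (by norm_num)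
  have hAA : A ≤ A ^ 2 := by nlinarith
  refine ⟨?_, fun k => ?_, fun k => ?_, fun w => ?_, fun k w => ?_, fun k w => ?_, fun k w t => ?_,
    fun k l w => ?_⟩
  · exact Continuous.measurable (by fun_prop)
  · have := hs1 k; exact Continuous.measurable (by fun_prop)
  · have := hs1 k; have := hs2 k; exact Continuous.measurable (by fun_prop)
  · rw [abs_pow]
    have := pow_le_pow_left₀ (abs_nonneg _) (hu w) 2
    nlinarith
  · rw [abs_neg, abs_mul, abs_mul, abs_two]
    have : |ℓ (traceResolvent n z w) - c| * |ℓ (traceDeriv n z k w)| ≤ A * (A * r ^ 3) := by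
      gcongr; exacts [hu w, hp k w]
    have h2 : A ^ 2 * r ^ 3 ≤ A ^ 2 * 1 := by gcongr
    nlinarith
  · refine (abs_add_le _ _).trans ?_
    rw [abs_pow, abs_mul, abs_mul, abs_two]
    have h1 := pow_le_pow_left₀ (abs_nonneg _) (hp k w) 2
    have h2 : |ℓ (traceResolvent n z w) - c| * |ℓ (traceDerivTwo n z k w)| ≤ A * (A * r ^ 4) := by
      gcongr; exacts [hu w, hq k w]
    have h3 : A ^ 2 * r ^ 6 ≤ A ^ 2 * r ^ 4 := by gcongr
    have h4 : 0 ≤ A ^ 2 * r ^ 4 := by positivity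
    nlinarith
  · have a1 := norm_traceResolvent_update_sub_le hn hz hK k w t
    have a2 := norm_traceResolvent_taylor_one_le hn hz hK k w t
    have a3 := norm_traceResolvent_taylor_two_le hn hz hK k w t
    have b1 := (hℓ _).trans a1
    have b2 := (hℓ _).trans a2
    have b3 := (hℓ _).trans a3
    have lin : ∀ (x : ℝ) (y : ℂ), ℓ ((x : ℂ) * y) = x * ℓ y := fun x y => by
      rw [← Complex.real_smul, map_smul, smul_eq_mul]
    rw [← Complex.ofReal_pow] at b3
    simp only [map_sub, map_add, lin] at b1 b2 b3
    have hu' := hu (Function.update w k 0)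
    have hp' := hp k (Function.update w k 0)
    have hq' := hq k (Function.update w k 0)
    set s := ℓ (traceResolvent n z (Function.update w k t))
    set s0 := ℓ (traceResolvent n z (Function.update w k 0))
    set s1 := ℓ (traceDeriv n z k (Function.update w k 0))
    set s2 := ℓ (traceDerivTwo n z k (Function.update w k 0))
    have hr2 : r ^ 2 ≤ 1 := pow_le_one₀ hr0 hr1
    have ht2 : |t| ^ 2 = t ^ 2 := sq_abs t
    have main := abs_sq_taylor_le (A := A) (b := r ^ 2) (τ := r * |t|) (u := s0 - c)
      (p := -(t * s1)) (q := t ^ 2 * s2) (R := s - s0) (by positivity) hr2 hA1 (by positivity) hu'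
      (by rw [abs_neg, abs_mul]
          calc |t| * |s1| ≤ |t| * (A * r ^ 3) := by gcongr
            _ = _ := by ring)
      (by rw [abs_mul, abs_pow]
          calc |t| ^ 2 * |s2| ≤ |t| ^ 2 * (A * r ^ 4) := by gcongr
            _ = _ := by ring)
      (by rw [sub_neg_eq_add]; refine b3.trans (le_of_eq ?_); ring)
      (by rw [sub_neg_eq_add]; refine b2.trans ?_
          calc _ ≤ A * r ^ 4 * |t| ^ 2 := by gcongr; linarith
            _ = _ := by ring)
      (by refine b1.trans ?_
          calc _ ≤ A * r ^ 3 * |t| := by gcongr; linarith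
            _ = _ := by ring)
    refine le_trans (le_of_eq ?_) (main.trans (le_of_eq ?_))
    · congr 1; ring
    · rw [mul_pow r, ht2]; ring
  · have a0 := (hℓ _).trans (norm_traceResolvent_sub_le (n := n) hz hK hK1 l w)
    have a1 := (hℓ _).trans (norm_traceDeriv_sub_le hn hz hK hK1 k l w)
    have a2 := (hℓ _).trans (norm_traceDerivTwo_sub_le hn hz hK hK1 k l w)
    simp only [map_sub] at a0 a1 a2
    have hm : 0 ≤ min 1 (r * |w l|) := le_min zero_le_one (by positivity)
    rw [← hr] at a0 a1 a2
    have hu' := hu w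
    have hp' := hp k w
    have hp'' := hp k (Function.update w l 0)
    have hq'' := hq k (Function.update w l 0)
    set m := min 1 (r * |w l|)
    set s := ℓ (traceResolvent n z w)
    set s1 := ℓ (traceDeriv n z k w)
    set s2 := ℓ (traceDerivTwo n z k w)
    set s' := ℓ (traceResolvent n z (Function.update w l 0))
    set s1' := ℓ (traceDeriv n z k (Function.update w l 0))
    set s2' := ℓ (traceDerivTwo n z k (Function.update w l 0))
    have c0 : |s' - s| ≤ A * m := a0.trans (by gcongr; linarith)
    have c1 : |s1' - s1| ≤ A * r ^ 3 * m := a1.trans (by gcongr; linarith)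
    have c2 : |s2' - s2| ≤ 3 * A * r ^ 4 * m := by
      refine a2.trans (le_of_eq ?_)
      rw [hA]; ring
    have heq : s1 ^ 2 + 2 * (s - c) * s2 - (s1' ^ 2 + 2 * (s' - c) * s2')
        = -((s1' - s1) * (s1' + s1) + (2 * ((s' - s) * s2') + 2 * ((s - c) * (s2' - s2)))) := by ring
    rw [heq, abs_neg]
    refine (abs_add_le _ _).trans ?_
    have e1 : |(s1' - s1) * (s1' + s1)| ≤ A * r ^ 3 * m * (A * r ^ 3 + A * r ^ 3) := by
      rw [abs_mul]; gcongr; exact (abs_add_le _ _).trans (add_le_add hp'' hp')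
    have e2 : |(s' - s) * s2'| ≤ A * m * (A * r ^ 4) := by rw [abs_mul]; gcongr
    have e3 : |(s - c) * (s2' - s2)| ≤ A * (3 * A * r ^ 4 * m) := by rw [abs_mul]; gcongr
    have e4 : |2 * ((s' - s) * s2') + 2 * ((s - c) * (s2' - s2))|
        ≤ 2 * (A * m * (A * r ^ 4)) + 2 * (A * (3 * A * r ^ 4 * m)) := by
      refine (abs_add_le _ _).trans ?_
      rw [abs_mul 2, abs_mul 2, abs_two]; linarith
    have e5 : A ^ 2 * r ^ 6 * m ≤ A ^ 2 * r ^ 4 * m := by gcongr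
    have e6 : 0 ≤ A ^ 2 * r ^ 4 * m := by positivity
    nlinarith

/-! ### Freezing an independent variable, and conditioning. -/

theorem integral_eq_integral_integral_of_indepFun {Ω A B : Type*} [MeasurableSpace Ω]
    [MeasurableSpace A] [MeasurableSpace B] {μ : Measure Ω} [IsProbabilityMeasure μ] {U : Ω → A}
    {V : Ω → B} (hU : Measurable U) (hV : Measurable V) (h : IndepFun U V μ) {g : A × B → ℝ}
    (hg : Measurable g) (hint : Integrable (fun ω => g (U ω, V ω)) μ) :
    ∫ ω, g (U ω, V ω) ∂μ = ∫ ω', ∫ ω, g (U ω, V ω') ∂μ ∂μ := by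
  have hmap := (indepFun_iff_map_prod_eq_prod_map_map hU.aemeasurable hV.aemeasurable).1 h
  have : IsProbabilityMeasure (μ.map U) := Measure.isProbabilityMeasure_map hU.aemeasurable
  have : IsProbabilityMeasure (μ.map V) := Measure.isProbabilityMeasure_map hV.aemeasurable
  have hUV : Measurable fun ω => (U ω, V ω) := hU.prodMk hV
  have hint' : Integrable g ((μ.map U).prod (μ.map V)) := by
    rw [← hmap]
    exact (integrable_map_measure hg.aestronglyMeasurable hUV.aemeasurable).2 hint
  rw [← integral_map (φ := fun ω => (U ω, V ω)) hUV.aemeasurable hg.aestronglyMeasurable, hmap,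
    integral_prod_symm _ hint']
  rw [integral_map hV.aemeasurable]
  · refine integral_congr_ae (Eventually.of_forall fun ω' => ?_)
    exact integral_map hU.aemeasurable
      (hg.comp (measurable_id.prodMk measurable_const)).aestronglyMeasurable
  · exact hg.stronglyMeasurable.integral_prod_left'.aestronglyMeasurable

/-- This allows hypotheses about the σ-field of `X` alone to be used when the integrand also
contains Gaussian entries: freeze those and bound uniformly in the frozen value. -/
theorem abs_integral_le_of_indepFun {Ω A B : Type*} [MeasurableSpace Ω]
    [MeasurableSpace A] [MeasurableSpace B] {μ : Measure Ω} [IsProbabilityMeasure μ] {U : Ω → A}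
    {V : Ω → B} (hU : Measurable U) (hV : Measurable V) (h : IndepFun U V μ) {g : A × B → ℝ}
    (hg : Measurable g) (hint : Integrable (fun ω => g (U ω, V ω)) μ) {e : ℝ}
    (he : ∀ v, |∫ ω, g (U ω, v) ∂μ| ≤ e) :
    |∫ ω, g (U ω, V ω) ∂μ| ≤ e := by
  rw [integral_eq_integral_integral_of_indepFun hU hV h hg hint]
  have := norm_integral_le_of_norm_le_const (μ := μ) (C := e)
    (Eventually.of_forall fun ω' => (Real.norm_eq_abs _).le.trans (he (V ω')))
  simpa using this

/-- The measurable factor is pulled out of the conditional expectation before being bounded. -/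
theorem abs_integral_mul_le_integral_condExp {Ω : Type*} {m mΩ : MeasurableSpace Ω} {μ : Measure Ω}
    [IsProbabilityMeasure μ] (hm : m ≤ mΩ) {V f : Ω → ℝ} (hV : StronglyMeasurable[m] V) {c : ℝ}
    (hc : ∀ ω, |V ω| ≤ c) (hf : Integrable f μ) :
    |∫ ω, V ω * f ω ∂μ| ≤ c * ∫ ω, |(μ[f | m]) ω| ∂μ := by
  have hVf : Integrable (V * f) μ :=
    hf.bdd_mul (hV.mono hm).aestronglyMeasurable (Eventually.of_forall hc)
  have h1 : ∫ ω, V ω * f ω ∂μ = ∫ ω, V ω * (μ[f | m]) ω ∂μ := by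
    have h2 := integral_condExp (μ := μ) (f := V * f) hm
    rw [integral_congr_ae (condExp_mul_of_stronglyMeasurable_left hV hVf hf)] at h2
    exact h2.symm
  rw [h1, ← integral_const_mul]
  refine (abs_integral_le_integral_abs).trans
    (integral_mono_of_nonneg (Eventually.of_forall fun _ => abs_nonneg _)
      (integrable_condExp.abs.const_mul c) (Eventually.of_forall fun ω => ?_))
  simp only [abs_mul]
  gcongr
  exact hc ω

theorem measurable_config {Ω : Type*} {m : MeasurableSpace Ω} {w : Ω → ℤ × ℤ → ℝ}
    (hw : ∀ p, Measurable fun ω => w ω p) : Measurable w :=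
  measurable_pi_iff.2 hw

/-! ### Hybrid configurations, windows and the past σ-field. -/

/-- The configuration equal to `x` on `s` and to `y` off `s`. -/
def hybrid (s : Finset (ℤ × ℤ)) (x y : ℤ × ℤ → ℝ) (p : ℤ × ℤ) : ℝ :=
  if p ∈ s then x p else y p

theorem measurable_hybrid (s : Finset (ℤ × ℤ)) :
    Measurable fun q : (ℤ × ℤ → ℝ) × (ℤ × ℤ → ℝ) => hybrid s q.1 q.2 := by
  refine measurable_pi_iff.2 fun p => ?_
  unfold hybrid
  split_ifs <;> fun_prop

theorem measurable_update_zero (a : ℤ × ℤ) :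
    Measurable fun w : ℤ × ℤ → ℝ => Function.update w a 0 := by
  refine measurable_pi_iff.2 fun p => ?_
  simp only [Function.update_apply]
  split_ifs <;> fun_prop

/-- The set of indices of `T` at sup-distance less than `b` from `a`. -/
def window (T : Finset (ℤ × ℤ)) (b : ℕ) (a : ℤ × ℤ) : Finset (ℤ × ℤ) :=
  T.filter fun l => max |l.1 - a.1| |l.2 - a.2| < (b : ℤ)

/-- Erase the coordinates one at a time: each still has its original value `w l` when its turn
comes, so the Lipschitz costs add up. -/
theorem HasExpansion.abs_sub_hybrid_zero_le {r C : ℝ} {φ : (ℤ × ℤ → ℝ) → ℝ}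
    {d₁ d₂ : ℤ × ℤ → (ℤ × ℤ → ℝ) → ℝ} (h : HasExpansion r C φ d₁ d₂) (k : ℤ × ℤ)
    (R : Finset (ℤ × ℤ)) (w : ℤ × ℤ → ℝ) :
    |d₂ k w - d₂ k (hybrid R 0 w)| ≤ C * r ^ 4 * ∑ l ∈ R, min 1 (r * |w l|) := by
  induction R using Finset.induction_on with
  | empty =>
    have : hybrid ∅ 0 w = w := by funext p; simp [hybrid]
    simp [this]
  | insert l R hl ih =>
    have h1 : hybrid (insert l R) 0 w = Function.update (hybrid R 0 w) l 0 := by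
      funext p
      by_cases hp : p = l <;> simp [hybrid, hp]
    have h2 := h.lipschitz₂ k l (hybrid R 0 w)
    have h3 : hybrid R 0 w l = w l := by simp [hybrid, hl]
    rw [← h1, h3] at h2
    rw [Finset.sum_insert hl, mul_add]
    refine (abs_sub_le _ _ _).trans ((add_le_add ih h2).trans (le_of_eq (add_comm _ _)))

theorem measurable_pastSigma {Ω : Type*} {X : ℤ × ℤ → Ω → ℝ} {b : ℕ} {a p : ℤ × ℤ}
    (hp : p ∈ pastIndex b a.1 a.2) (hp' : p.2 ≤ p.1) :
    Measurable[pastSigma X b a.1 a.2] (X p) := by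
  have h : MeasurableSpace.comap (X p) (borel ℝ) ≤ pastSigma X b a.1 a.2 :=
    le_iSup₂ (f := fun p _ => MeasurableSpace.comap (X p) (borel ℝ)) p ⟨hp, hp'⟩
  rw [measurable_iff_comap_le]
  convert h
  exact BorelSpace.measurable_eq

theorem pastSigma_le {Ω : Type*} [mΩ : MeasurableSpace Ω] {X : ℤ × ℤ → Ω → ℝ}
    (hX : ∀ p, Measurable (X p)) (b : ℕ) (i j : ℤ) : pastSigma X b i j ≤ mΩ := by
  refine iSup₂_le fun p _ => ?_
  have := (hX p).comap_le
  rwa [BorelSpace.measurable_eq (α := ℝ)] at this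

/-- The bound for the effect of exchanging the entry `a` in Lindeberg's method. -/
def exchangeError {Ω : Type*} [MeasurableSpace Ω] (μ : Measure Ω) (X Z : ℤ × ℤ → Ω → ℝ)
    (T : Finset (ℤ × ℤ)) (b : ℕ) (r : ℝ) (a : ℤ × ℤ) : ℝ :=
  (∫ ω, X a ω ^ 2 * min 1 (r * |X a ω|) ∂μ) + (∫ ω, Z a ω ^ 2 * min 1 (r * |Z a ω|) ∂μ)
    + (∫ ω, |(μ[fun ω => X a ω ^ 2 - ∫ ω', X a ω' ^ 2 ∂μ | pastSigma X b a.1 a.2]) ω| ∂μ)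
    + ∑ l ∈ window T b a, ∫ ω, min 1 (r * |X l ω|) * (X a ω ^ 2 + ∫ ω', X a ω' ^ 2 ∂μ) ∂μ

theorem integrable_mul_min {Ω : Type*} [MeasurableSpace Ω] {μ : Measure Ω} {r : ℝ} {f g : Ω → ℝ} (hr : 0 ≤ r)
    (hf : Integrable f μ) (hg : Measurable g) :
    Integrable (fun ω => f ω * min 1 (r * |g ω|)) μ := by
  refine hf.mul_bdd (c := 1) (by fun_prop) (Eventually.of_forall fun ω => ?_)
  rw [Real.norm_of_nonneg (le_min zero_le_one (by positivity))]
  exact min_le_left _ _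

/-! ### Lindeberg's exchange of one entry, then of all. -/

section Step

variable {Ω : Type*} [MeasurableSpace Ω] {μ : Measure Ω} [IsProbabilityMeasure μ]
  {X Z : ℤ × ℤ → Ω → ℝ} {r C : ℝ} {φ : (ℤ × ℤ → ℝ) → ℝ} {d₁ d₂ : ℤ × ℤ → (ℤ × ℤ → ℝ) → ℝ}
  {T s : Finset (ℤ × ℤ)} {a : ℤ × ℤ}

theorem abs_integral_taylor_le (hr : 0 ≤ r) (h : HasExpansion r C φ d₁ d₂)
    {w : Ω → ℤ × ℤ → ℝ} (hw : Measurable w) {V : Ω → ℝ} (hV : Measurable V) (hV2 : MemLp V 2 μ) :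
    |∫ ω, φ (Function.update (w ω) a (V ω)) ∂μ
      - (∫ ω, φ (Function.update (w ω) a 0) ∂μ + ∫ ω, d₁ a (Function.update (w ω) a 0) * V ω ∂μ
        + ∫ ω, d₂ a (Function.update (w ω) a 0) * V ω ^ 2 ∂μ)|
      ≤ C * r ^ 4 * ∫ ω, V ω ^ 2 * min 1 (r * |V ω|) ∂μ := by
  have hw0 : Measurable fun ω => Function.update (w ω) a 0 := (measurable_update_zero a).comp hw
  have hwV : Measurable fun ω => Function.update (w ω) a (V ω) := by
    refine measurable_pi_iff.2 fun p => ?_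
    simp only [Function.update_apply]
    split_ifs <;> fun_prop
  have hVi : Integrable V μ := hV2.integrable (by norm_num)
  have hVsq : Integrable (fun ω => V ω ^ 2) μ := hV2.integrable_sq
  have i0 : Integrable (fun ω => φ (Function.update (w ω) a (V ω))) μ :=
    Integrable.of_bound (h.measurable.comp hwV).aestronglyMeasurable C
      (Eventually.of_forall fun ω => h.bound _)
  have i1 : Integrable (fun ω => φ (Function.update (w ω) a 0)) μ :=
    Integrable.of_bound (h.measurable.comp hw0).aestronglyMeasurable C
      (Eventually.of_forall fun ω => h.bound _)
  have i2 : Integrable (fun ω => d₁ a (Function.update (w ω) a 0) * V ω) μ :=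
    hVi.bdd_mul ((h.measurable₁ a).comp hw0).aestronglyMeasurable
      (Eventually.of_forall fun ω => h.bound₁ _ _)
  have i3 : Integrable (fun ω => d₂ a (Function.update (w ω) a 0) * V ω ^ 2) μ :=
    hVsq.bdd_mul ((h.measurable₂ a).comp hw0).aestronglyMeasurable
      (Eventually.of_forall fun ω => h.bound₂ _ _)
  have i12 : Integrable (fun ω => φ (Function.update (w ω) a 0)
    + d₁ a (Function.update (w ω) a 0) * V ω) μ := i1.add i2
  have i123 : Integrable (fun ω => φ (Function.update (w ω) a 0)
    + d₁ a (Function.update (w ω) a 0) * V ω + d₂ a (Function.update (w ω) a 0) * V ω ^ 2) μ :=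
    i12.add i3
  rw [← integral_add i1 i2, ← integral_add i12 i3, ← integral_sub i0 i123, ← integral_const_mul]
  refine abs_integral_le_integral_abs.trans (integral_mono_of_nonneg
    (Eventually.of_forall fun _ => abs_nonneg _) ((integrable_mul_min hr hVsq hV).const_mul _)
    (Eventually.of_forall fun ω => ?_))
  have := h.taylor a (w ω) (V ω)
  refine le_trans (le_of_eq (congrArg abs ?_)) this
  ring

/-- With the Gaussian entries frozen, the configuration depends only on entries of `X` strictly
before `a`, so the martingale difference property annihilates the integral. -/
theorem integral_mul_entry_eq_zero (hXmeas : ∀ p, Measurable (X p)) (hXL2 : ∀ p, MemLp (X p) 2 μ)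
    (hZmeas : ∀ p, Measurable (Z p))
    (hXZ : IndepFun (fun ω p => X p ω) (fun ω p => Z p ω) μ)
    (hmart : μ[X a | pastSigma X 1 a.1 a.2] =ᵐ[μ] 0)
    (hs : ∀ p ∈ s, p.2 ≤ p.1 ∧ toLex p < toLex a)
    {d : (ℤ × ℤ → ℝ) → ℝ} (hd : Measurable d) (hdC : ∀ w, |d w| ≤ C) :
    ∫ ω, d (Function.update (hybrid s (fun p => X p ω) fun p => Z p ω) a 0) * X a ω ∂μ = 0 := by
  have hXi : Integrable (X a) μ := (hXL2 a).integrable (by norm_num)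
  have hcfg : Measurable fun q : (ℤ × ℤ → ℝ) × (ℤ × ℤ → ℝ) =>
      d (Function.update (hybrid s q.1 q.2) a 0) :=
    hd.comp ((measurable_update_zero a).comp (measurable_hybrid s))
  have hmX := measurable_config hXmeas
  have hmZ := measurable_config hZmeas
  have key := abs_integral_le_of_indepFun (μ := μ) hmX hmZ hXZ
    (g := fun q => d (Function.update (hybrid s q.1 q.2) a 0) * q.1 a)
    (hcfg.mul ((measurable_pi_apply a).comp measurable_fst))
    (hXi.bdd_mul (hcfg.comp (hmX.prodMk hmZ)).aestronglyMeasurable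
      (Eventually.of_forall fun ω => hdC _)) (e := 0) fun v => by
        have hm := pastSigma_le hXmeas 1 a.1 a.2
        have hmeas : Measurable[pastSigma X 1 a.1 a.2] fun ω =>
            Function.update (hybrid s (fun p => X p ω) v) a 0 := by
          refine measurable_config fun p => ?_
          simp only [Function.update_apply, hybrid]
          split_ifs with h1 h2
          · exact measurable_const
          · refine measurable_pastSigma ⟨?_, (hs p h2).2.le⟩ (hs p h2).1
            -- At sup-distance less than `1` from `a` there is only `a` itself, whose coordinate is
            -- already zero.
            by_contra! hlt
            apply h1
            have h3 := abs_lt.1 (lt_of_le_of_lt (le_max_left _ _) hlt)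
            have h4 := abs_lt.1 (lt_of_le_of_lt (le_max_right _ _) hlt)
            push_cast at h3 h4
            exact Prod.ext (by omega) (by omega)
          · exact measurable_const
        have := abs_integral_mul_le_integral_condExp hm (hd.comp hmeas).stronglyMeasurable
          (fun ω => hdC _) hXi
        refine this.trans (le_of_eq ?_)
        have hz : ∫ ω, |(μ[X a | pastSigma X 1 a.1 a.2]) ω| ∂μ = ∫ ω, (0 : ℝ) ∂μ :=
          integral_congr_ae (hmart.mono fun ω hω => by simp [hω])
        rw [hz]; simp
  exact abs_nonpos_iff.1 key

/-- With `X` frozen, the coefficient sees only Gaussian coordinates other than `a`, hence is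
independent of `Z a`. The function `g` is the identity at first order and the centered square at
second order. -/
theorem integral_mul_gaussian_eq_zero (hXmeas : ∀ p, Measurable (X p))
    (hZmeas : ∀ p, Measurable (Z p))
    (hXZ : IndepFun (fun ω p => X p ω) (fun ω p => Z p ω) μ)
    (hZind : IndepFun (Z a) (fun ω => Function.update (fun p => Z p ω) a 0) μ)
    {d : (ℤ × ℤ → ℝ) → ℝ} (hd : Measurable d) (hdC : ∀ w, |d w| ≤ C)
    {g : ℝ → ℝ} (hg : Measurable g) (hgi : Integrable (fun ω => g (Z a ω)) μ)
    (hg0 : ∫ ω, g (Z a ω) ∂μ = 0) :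
    ∫ ω, d (Function.update (hybrid s (fun p => X p ω) fun p => Z p ω) a 0) * g (Z a ω) ∂μ = 0 := by
  have hcfg : Measurable fun q : (ℤ × ℤ → ℝ) × (ℤ × ℤ → ℝ) =>
      d (Function.update (hybrid s q.2 q.1) a 0) :=
    hd.comp ((measurable_update_zero a).comp ((measurable_hybrid s).comp measurable_swap))
  have hmX := measurable_config hXmeas
  have hmZ := measurable_config hZmeas
  have key := abs_integral_le_of_indepFun (μ := μ) hmZ hmX hXZ.symm
    (g := fun q => d (Function.update (hybrid s q.2 q.1) a 0) * g (q.1 a))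
    (hcfg.mul (hg.comp ((measurable_pi_apply a).comp measurable_fst)))
    (hgi.bdd_mul (hcfg.comp (hmZ.prodMk hmX)).aestronglyMeasurable
      (Eventually.of_forall fun ω => hdC _)) (e := 0) fun x => by
        have hup : ∀ y, Function.update (hybrid s x y) a 0
            = Function.update (hybrid s x (Function.update y a 0)) a 0 := fun y => by
          funext p
          by_cases hp : p = a <;> simp [hybrid, hp]
        have hD : Measurable fun y => d (Function.update (hybrid s x y) a 0) :=
          hcfg.comp (measurable_id.prodMk measurable_const)
        have := (hZind.symm.comp hD hg).integral_fun_mul_eq_mul_integral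
          (hD.comp ((measurable_update_zero a).comp hmZ)).aestronglyMeasurable
          (hg.comp (hZmeas a)).aestronglyMeasurable
        simp only [Function.comp_apply, ← hup] at this
        rw [hg0, mul_zero] at this
        simp only [this, abs_zero, le_refl]
  exact abs_nonpos_iff.1 key

/-- Zeroing the `X` coordinates near `a` makes the coefficient `pastSigma X b`-measurable for frozen
`Z`, so only the conditional expectation of the centered square matters. The Lipschitz property of
`d₂` pays for the zeroing. -/
theorem abs_integral_mul_sq_sub_le (hr : 0 ≤ r) (h : HasExpansion r C φ d₁ d₂)
    (hXmeas : ∀ p, Measurable (X p)) (hXL2 : ∀ p, MemLp (X p) 2 μ)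
    (hZmeas : ∀ p, Measurable (Z p))
    (hXZ : IndepFun (fun ω p => X p ω) (fun ω p => Z p ω) μ)
    (hsT : s ⊆ T) (hs : ∀ p ∈ s, p.2 ≤ p.1 ∧ toLex p < toLex a) (b : ℕ) :
    |∫ ω, d₂ a (Function.update (hybrid s (fun p => X p ω) fun p => Z p ω) a 0) *
        (X a ω ^ 2 - ∫ ω', X a ω' ^ 2 ∂μ) ∂μ|
      ≤ C * r ^ 4 * ((∫ ω, |(μ[fun ω => X a ω ^ 2 - ∫ ω', X a ω' ^ 2 ∂μ |
            pastSigma X b a.1 a.2]) ω| ∂μ)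
        + ∑ l ∈ window T b a, ∫ ω, min 1 (r * |X l ω|) * (X a ω ^ 2 + ∫ ω', X a ω' ^ 2 ∂μ) ∂μ) := by
  set v := ∫ ω', X a ω' ^ 2 ∂μ with hv
  have hv0 : 0 ≤ v := integral_nonneg fun _ => sq_nonneg _
  have hCr : 0 ≤ C * r ^ 4 := (abs_nonneg _).trans (h.bound₂ a 0)
  -- Only coordinates already exchanged have to be erased; the nearby Gaussian ones are frozen. The
  -- sum is enlarged to the window of `T` at the end, so that the bound no longer depends on `s`.
  set R := window s b a with hR
  have hmX := measurable_config hXmeas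
  have hmZ := measurable_config hZmeas
  have hXsq : Integrable (fun ω => X a ω ^ 2) μ := (hXL2 a).integrable_sq
  have hf : Integrable (fun ω => X a ω ^ 2 - v) μ := hXsq.sub (integrable_const v)
  have hf' : Integrable (fun ω => X a ω ^ 2 + v) μ := hXsq.add (integrable_const v)
  have hcfg : Measurable fun q : (ℤ × ℤ → ℝ) × (ℤ × ℤ → ℝ) =>
      Function.update (hybrid s q.1 q.2) a 0 := (measurable_update_zero a).comp (measurable_hybrid s)
  have hcfgR : Measurable fun q : (ℤ × ℤ → ℝ) × (ℤ × ℤ → ℝ) =>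
      hybrid R 0 (Function.update (hybrid s q.1 q.2) a 0) :=
    (measurable_hybrid R).comp (measurable_const.prodMk hcfg)
  have hD := ((h.measurable₂ a).comp hcfg).comp (hmX.prodMk hmZ)
  have hDR := ((h.measurable₂ a).comp hcfgR).comp (hmX.prodMk hmZ)
  have i1 := hf.bdd_mul hD.aestronglyMeasurable (Eventually.of_forall fun ω => h.bound₂ a _)
  have i2 := hf.bdd_mul hDR.aestronglyMeasurable (Eventually.of_forall fun ω => h.bound₂ a _)
  have hmeasg : Measurable fun q : (ℤ × ℤ → ℝ) × (ℤ × ℤ → ℝ) =>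
      d₂ a (hybrid R 0 (Function.update (hybrid s q.1 q.2) a 0)) * (q.1 a ^ 2 - v) :=
    ((h.measurable₂ a).comp hcfgR).mul (by fun_prop)
  have main := abs_integral_le_of_indepFun (μ := μ) hmX hmZ hXZ hmeasg i2
    (e := C * r ^ 4 * ∫ ω, |(μ[fun ω => X a ω ^ 2 - v | pastSigma X b a.1 a.2]) ω| ∂μ) fun y => by
      have hm := pastSigma_le hXmeas b a.1 a.2
      have hmeas : Measurable[pastSigma X b a.1 a.2] fun ω =>
          hybrid R 0 (Function.update (hybrid s (fun p => X p ω) y) a 0) := by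
        refine measurable_config fun p => ?_
        simp only [Function.update_apply, hybrid]
        split_ifs with h0 h1 h2
        · exact measurable_const
        · exact measurable_const
        · refine measurable_pastSigma ⟨?_, (hs p h2).2.le⟩ (hs p h2).1
          by_contra! hlt
          exact h0 (Finset.mem_filter.2 ⟨h2, hlt⟩)
        · exact measurable_const
      exact abs_integral_mul_le_integral_condExp hm ((h.measurable₂ a).comp hmeas).stronglyMeasurable
        (fun ω => h.bound₂ a _) hf
  have hRT : R ⊆ window T b a := Finset.filter_subset_filter _ hsT
  have hterm : ∀ l ω, 0 ≤ min 1 (r * |X l ω|) * (X a ω ^ 2 + v) := fun l ω =>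
    mul_nonneg (le_min zero_le_one (by positivity)) (by positivity)
  have iterm : ∀ l, Integrable (fun ω => min 1 (r * |X l ω|) * (X a ω ^ 2 + v)) μ := fun l =>
    (integrable_mul_min hr hf' (hXmeas l)).congr (Eventually.of_forall fun ω => mul_comm _ _)
  have err : |∫ ω, d₂ a (Function.update (hybrid s (fun p => X p ω) fun p => Z p ω) a 0) *
        (X a ω ^ 2 - v) ∂μ - ∫ ω, d₂ a (hybrid R 0
          (Function.update (hybrid s (fun p => X p ω) fun p => Z p ω) a 0)) * (X a ω ^ 2 - v) ∂μ|
      ≤ C * r ^ 4 * ∑ l ∈ R, ∫ ω, min 1 (r * |X l ω|) * (X a ω ^ 2 + v) ∂μ := by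
    rw [← integral_finsetSum R (fun l _ => iterm l), ← integral_const_mul]
    refine (congrArg abs (integral_sub i1 i2)).symm.le.trans ?_
    refine abs_integral_le_integral_abs.trans (integral_mono_of_nonneg
      (Eventually.of_forall fun _ => abs_nonneg _)
      ((integrable_finsetSum R fun l _ => iterm l).const_mul _) (Eventually.of_forall fun ω => ?_))
    have h1 := h.abs_sub_hybrid_zero_le a R
      (Function.update (hybrid s (fun p => X p ω) fun p => Z p ω) a 0)
    have h2 : ∀ l ∈ R, Function.update (hybrid s (fun p => X p ω) fun p => Z p ω) a 0 l = X l ω := by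
      intro l hl
      have hls := (Finset.mem_filter.1 hl).1
      have hla : l ≠ a := fun e => (hs l hls).2.ne (by rw [e])
      simp [hybrid, hls, hla]
    rw [Finset.sum_congr rfl fun l hl => by rw [h2 l hl]] at h1
    have h3 : |X a ω ^ 2 - v| ≤ X a ω ^ 2 + v := by
      refine (abs_sub _ _).trans (le_of_eq ?_)
      rw [abs_of_nonneg (sq_nonneg _), abs_of_nonneg hv0]
    simp only [Function.comp_apply]
    rw [← sub_mul, abs_mul, ← Finset.sum_mul, ← mul_assoc]
    exact mul_le_mul h1 h3 (abs_nonneg _) ((abs_nonneg _).trans h1)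
  have hsum : ∑ l ∈ R, ∫ ω, min 1 (r * |X l ω|) * (X a ω ^ 2 + v) ∂μ
      ≤ ∑ l ∈ window T b a, ∫ ω, min 1 (r * |X l ω|) * (X a ω ^ 2 + v) ∂μ :=
    Finset.sum_le_sum_of_subset_of_nonneg hRT fun l _ _ => integral_nonneg (hterm l)
  have hfin := (abs_sub_abs_le_abs_sub _ _).trans err
  have hsum' := mul_le_mul_of_nonneg_left hsum hCr
  dsimp only at main
  rw [mul_add]
  linarith

/-- Both configurations are updates at `a` of the same `w`. Expanding each around the value `0`
cancels the zeroth order terms; first order terms vanish, and second order terms are compared after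
subtracting the common variance. -/
theorem abs_exchange_le (hr : 0 ≤ r) (h : HasExpansion r C φ d₁ d₂)
    (hXmeas : ∀ p, Measurable (X p)) (hXL2 : ∀ p, MemLp (X p) 2 μ)
    (hZmeas : ∀ p, Measurable (Z p)) (hZL2 : MemLp (Z a) 2 μ)
    (hXZ : IndepFun (fun ω p => X p ω) (fun ω p => Z p ω) μ)
    (hmart : μ[X a | pastSigma X 1 a.1 a.2] =ᵐ[μ] 0)
    (hZind : IndepFun (Z a) (fun ω => Function.update (fun p => Z p ω) a 0) μ)
    (hZmean : ∫ ω, Z a ω ∂μ = 0) (hZvar : ∫ ω, Z a ω ^ 2 ∂μ = ∫ ω, X a ω ^ 2 ∂μ)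
    (hsT : s ⊆ T) (has : a ∉ s) (hs : ∀ p ∈ s, p.2 ≤ p.1 ∧ toLex p < toLex a) (b : ℕ) :
    |∫ ω, φ (hybrid (insert a s) (fun p => X p ω) fun p => Z p ω) ∂μ
      - ∫ ω, φ (hybrid s (fun p => X p ω) fun p => Z p ω) ∂μ|
      ≤ C * r ^ 4 * exchangeError μ X Z T b r a := by
  have hmX := measurable_config hXmeas
  have hmZ := measurable_config hZmeas
  set w : Ω → ℤ × ℤ → ℝ := fun ω => hybrid s (fun p => X p ω) fun p => Z p ω with hwdef
  have hw : Measurable w := (measurable_hybrid s).comp (hmX.prodMk hmZ)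
  have e1 : ∀ ω, hybrid (insert a s) (fun p => X p ω) (fun p => Z p ω)
      = Function.update (w ω) a (X a ω) := fun ω => by
    funext p
    by_cases hp : p = a
    · subst hp; simp [hybrid]
    · simp [hybrid, hwdef, hp]
  have e2 : ∀ ω, w ω = Function.update (w ω) a (Z a ω) := fun ω => by
    rw [eq_comm, Function.update_eq_self_iff]
    simp [hybrid, hwdef, has]
  have tX := abs_integral_taylor_le (a := a) hr h hw (hXmeas a) (hXL2 a)
  have tZ := abs_integral_taylor_le (a := a) hr h hw (hZmeas a) hZL2
  have x1 : ∫ ω, d₁ a (Function.update (w ω) a 0) * X a ω ∂μ = 0 :=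
    integral_mul_entry_eq_zero hXmeas hXL2 hZmeas hXZ hmart hs (h.measurable₁ a) (h.bound₁ a)
  have z1 : ∫ ω, d₁ a (Function.update (w ω) a 0) * Z a ω ∂μ = 0 :=
    integral_mul_gaussian_eq_zero hXmeas hZmeas hXZ hZind (h.measurable₁ a) (h.bound₁ a)
      measurable_id (hZL2.integrable (by norm_num)) hZmean
  have hw0 : Measurable fun ω => Function.update (w ω) a 0 := (measurable_update_zero a).comp hw
  set v := ∫ ω, X a ω ^ 2 ∂μ with hv
  have z2 : ∫ ω, d₂ a (Function.update (w ω) a 0) * (Z a ω ^ 2 - v) ∂μ = 0 :=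
    integral_mul_gaussian_eq_zero (g := fun t => t ^ 2 - v) hXmeas hZmeas hXZ hZind
      (h.measurable₂ a) (h.bound₂ a) (by fun_prop) (hZL2.integrable_sq.sub (integrable_const v))
      (by rw [integral_sub hZL2.integrable_sq (integrable_const v), hZvar]; simp)
  have x2 := abs_integral_mul_sq_sub_le (T := T) (s := s) (a := a) hr h hXmeas hXL2 hZmeas hXZ hsT hs b
  have hbdd : ∀ {g : Ω → ℝ}, Integrable g μ →
      Integrable (fun ω => d₂ a (Function.update (w ω) a 0) * g ω) μ := fun hg =>
    hg.bdd_mul ((h.measurable₂ a).comp hw0).aestronglyMeasurable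
      (Eventually.of_forall fun ω => h.bound₂ _ _)
  have split : ∀ {g : Ω → ℝ}, Integrable g μ →
      ∫ ω, d₂ a (Function.update (w ω) a 0) * (g ω - v) ∂μ
        = ∫ ω, d₂ a (Function.update (w ω) a 0) * g ω ∂μ
          - ∫ ω, d₂ a (Function.update (w ω) a 0) * v ∂μ := fun hg => by
    rw [← integral_sub (hbdd hg) (hbdd (integrable_const v))]
    simp only [mul_sub]
  have x2' : |∫ ω, d₂ a (Function.update (w ω) a 0) * (X a ω ^ 2 - v) ∂μ| ≤ _ := x2
  rw [split (hXL2 a).integrable_sq] at x2'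
  rw [split hZL2.integrable_sq] at z2
  have i1 : ∫ ω, φ (hybrid (insert a s) (fun p => X p ω) fun p => Z p ω) ∂μ
      = ∫ ω, φ (Function.update (w ω) a (X a ω)) ∂μ :=
    integral_congr_ae (Eventually.of_forall fun ω => congrArg φ (e1 ω))
  have i2 : ∫ ω, φ (w ω) ∂μ = ∫ ω, φ (Function.update (w ω) a (Z a ω)) ∂μ :=
    integral_congr_ae (Eventually.of_forall fun ω => congrArg φ (e2 ω))
  rw [i1, i2, exchangeError]
  rw [x1] at tX
  rw [z1] at tZ
  rw [abs_le] at tX tZ x2' ⊢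
  simp only [mul_add] at x2' ⊢
  constructor <;> linarith [tX.1, tX.2, tZ.1, tZ.2, x2'.1, x2'.2]

/-- Lindeberg's exchange of all the entries with index in a set of lower triangular indices. -/
theorem abs_integral_hybrid_sub_le (hr : 0 ≤ r) (h : HasExpansion r C φ d₁ d₂)
    (hXmeas : ∀ p, Measurable (X p)) (hXL2 : ∀ p, MemLp (X p) 2 μ)
    (hZmeas : ∀ p, Measurable (Z p)) (hZL2 : ∀ a ∈ T, MemLp (Z a) 2 μ)
    (hXZ : IndepFun (fun ω p => X p ω) (fun ω p => Z p ω) μ)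
    (hmart : ∀ a ∈ T, μ[X a | pastSigma X 1 a.1 a.2] =ᵐ[μ] 0)
    (hZind : ∀ a ∈ T, IndepFun (Z a) (fun ω => Function.update (fun p => Z p ω) a 0) μ)
    (hZmean : ∀ a ∈ T, ∫ ω, Z a ω ∂μ = 0)
    (hZvar : ∀ a ∈ T, ∫ ω, Z a ω ^ 2 ∂μ = ∫ ω, X a ω ^ 2 ∂μ)
    (hT : ∀ p ∈ T, p.2 ≤ p.1) (b : ℕ) :
    |∫ ω, φ (hybrid T (fun p => X p ω) fun p => Z p ω) ∂μ - ∫ ω, φ (fun p => Z p ω) ∂μ|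
      ≤ C * r ^ 4 * ∑ a ∈ T, exchangeError μ X Z T b r a := by
  suffices H : ∀ s : Finset (ℤ × ℤ), s ⊆ T →
      |∫ ω, φ (hybrid s (fun p => X p ω) fun p => Z p ω) ∂μ - ∫ ω, φ (fun p => Z p ω) ∂μ|
        ≤ C * r ^ 4 * ∑ a ∈ s, exchangeError μ X Z T b r a from H T subset_rfl
  intro s
  -- Inserting entries in increasing lexicographic order keeps all of `s` in the past of the new
  -- entry.
  induction s using Finset.induction_on_max_value (f := (toLex : ℤ × ℤ → Lex (ℤ × ℤ))) with
  | empty =>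
    intro _
    have : ∀ x y : ℤ × ℤ → ℝ, hybrid ∅ x y = y := fun x y => by funext p; simp [hybrid]
    simp [this]
  | insert a s has hmax ih =>
    intro hsub
    have haT := hsub (Finset.mem_insert_self a s)
    have hsT := (Finset.subset_insert a s).trans hsub
    have step := abs_exchange_le (T := T) hr h hXmeas hXL2 hZmeas (hZL2 a haT) hXZ (hmart a haT)
      (hZind a haT) (hZmean a haT) (hZvar a haT) hsT has (fun p hp => ⟨hT p (hsT hp),
        lt_of_le_of_ne (hmax p hp) fun e => has ((toLex.injective e) ▸ hp)⟩) b
    rw [Finset.sum_insert has, mul_add]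
    exact (abs_sub_le _ _ _).trans (add_le_add step (ih hsT))

end Step

/-! ### The Efron–Stein variance bound by successive averaging. -/

/-- A variance is at most the mean square deviation from any constant, here `h₀`. -/
theorem integral_sq_sub_sq_integral_le {Ω : Type*} [MeasurableSpace Ω] {μ : Measure Ω}
    [IsProbabilityMeasure μ] {h V : Ω → ℝ} (hh : Measurable h) {C L h₀ : ℝ} (hC : ∀ ω, |h ω| ≤ C)
    (hV : MemLp V 2 μ) (hL : ∀ ω, |h ω - h₀| ≤ L * |V ω|) :
    ∫ ω, h ω ^ 2 ∂μ - (∫ ω, h ω ∂μ) ^ 2 ≤ L ^ 2 * ∫ ω, V ω ^ 2 ∂μ := by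
  have ih : Integrable h μ := Integrable.of_bound hh.aestronglyMeasurable C
    (Eventually.of_forall hC)
  have ih2 : Integrable (fun ω => h ω ^ 2) μ :=
    Integrable.of_bound (hh.pow_const 2).aestronglyMeasurable (C ^ 2) (Eventually.of_forall fun ω => by
      rw [norm_pow]; exact pow_le_pow_left₀ (norm_nonneg _) (hC ω) 2)
  have i1 : Integrable (fun ω => 2 * h₀ * h ω) μ := ih.const_mul _
  have e : ∫ ω, (h ω - h₀) ^ 2 ∂μ = ∫ ω, h ω ^ 2 ∂μ - 2 * h₀ * (∫ ω, h ω ∂μ) + h₀ ^ 2 := by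
    have : ∀ ω, (h ω - h₀) ^ 2 = h ω ^ 2 - 2 * h₀ * h ω + h₀ ^ 2 := fun ω => by ring
    simp_rw [this]
    have i2 : Integrable (fun ω => h ω ^ 2 - 2 * h₀ * h ω) μ := ih2.sub i1
    rw [integral_add i2 (integrable_const _), integral_sub ih2 i1, integral_const_mul]
    simp
  have m : ∫ ω, (h ω - h₀) ^ 2 ∂μ ≤ L ^ 2 * ∫ ω, V ω ^ 2 ∂μ := by
    rw [← integral_const_mul]
    refine integral_mono_of_nonneg (Eventually.of_forall fun _ => sq_nonneg _)
      (hV.integrable_sq.const_mul _) (Eventually.of_forall fun ω => ?_)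
    have := pow_le_pow_left₀ (abs_nonneg _) (hL ω) 2
    rwa [mul_pow, sq_abs, sq_abs] at this
  nlinarith [sq_nonneg ((∫ ω, h ω ∂μ) - h₀)]

section Average

variable {Ω : Type*} [MeasurableSpace Ω] {μ : Measure Ω} [IsProbabilityMeasure μ]
  {Z : ℤ × ℤ → Ω → ℝ} {f : (ℤ × ℤ → ℝ) → ℝ} {C L : ℝ} {s : Finset (ℤ × ℤ)} {a : ℤ × ℤ}

/-- The average of `f` over the coordinates in `s`, for the field `Z`. -/
def partialAverage (μ : Measure Ω) (Z : ℤ × ℤ → Ω → ℝ) (f : (ℤ × ℤ → ℝ) → ℝ)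
    (s : Finset (ℤ × ℤ)) (x : ℤ × ℤ → ℝ) : ℝ :=
  ∫ ω, f (hybrid s (fun p => Z p ω) x) ∂μ

theorem measurable_partialAverage (hZ : ∀ p, Measurable (Z p)) (hf : Measurable f) :
    Measurable (partialAverage μ Z f s) := by
  have hmZ := measurable_config hZ
  have : Measurable fun q : (ℤ × ℤ → ℝ) × Ω => f (hybrid s (fun p => Z p q.2) q.1) :=
    hf.comp ((measurable_hybrid s).comp ((hmZ.comp measurable_snd).prodMk measurable_fst))
  exact this.stronglyMeasurable.integral_prod_right'.measurable

theorem integrable_bounded_comp {A : Type*} [MeasurableSpace A] {W : Ω → A} (hW : Measurable W)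
    {f : A → ℝ} (hf : Measurable f) (hC : ∀ x, |f x| ≤ C) : Integrable (fun ω => f (W ω)) μ :=
  Integrable.of_bound (hf.comp hW).aestronglyMeasurable C (Eventually.of_forall fun _ => hC _)

theorem abs_integral_le_of_bounded {h : Ω → ℝ} (hC : ∀ ω, |h ω| ≤ C) : |∫ ω, h ω ∂μ| ≤ C := by
  have := norm_integral_le_of_norm_le_const (μ := μ) (C := C) (f := h) (Eventually.of_forall hC)
  simpa using this

theorem abs_partialAverage_le (hC : ∀ x, |f x| ≤ C) (x : ℤ × ℤ → ℝ) :
    |partialAverage μ Z f s x| ≤ C :=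
  abs_integral_le_of_bounded fun _ => hC _

theorem measurable_update_pair (a : ℤ × ℤ) :
    Measurable fun q : (ℤ × ℤ → ℝ) × ℝ => Function.update q.1 a q.2 := by
  refine measurable_config fun p => ?_
  simp only [Function.update_apply]
  split_ifs <;> fun_prop

theorem hybrid_update_of_notMem (has : a ∉ s) (x y : ℤ × ℤ → ℝ) (t : ℝ) :
    hybrid s x (Function.update y a t) = Function.update (hybrid s x y) a t := by
  funext p
  by_cases hp : p = a
  · subst hp; simp [hybrid, has]
  · simp [hybrid, hp]

theorem partialAverage_lipschitz (hZ : ∀ p, Measurable (Z p)) (hf : Measurable f)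
    (hC : ∀ x, |f x| ≤ C)
    (hL : ∀ w t, |f (Function.update w a t) - f (Function.update w a 0)| ≤ L * |t|)
    (has : a ∉ s) (x : ℤ × ℤ → ℝ) (t : ℝ) :
    |partialAverage μ Z f s (Function.update x a t)
      - partialAverage μ Z f s (Function.update x a 0)| ≤ L * |t| := by
  have hmZ := measurable_config hZ
  have hi : ∀ y, Integrable (fun ω => f (hybrid s (fun p => Z p ω) y)) μ := fun y =>
    integrable_bounded_comp ((measurable_hybrid s).comp (hmZ.prodMk measurable_const)) hf hC
  rw [partialAverage, partialAverage, ← integral_sub (hi _) (hi _)]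
  refine abs_integral_le_of_bounded fun ω => ?_
  rw [hybrid_update_of_notMem has, hybrid_update_of_notMem has]
  exact hL _ t

theorem partialAverage_insert (hZ : ∀ p, Measurable (Z p)) (hf : Measurable f)
    (hC : ∀ x, |f x| ≤ C)
    (hZind : IndepFun (Z a) (fun ω => Function.update (fun p => Z p ω) a 0) μ)
    (has : a ∉ s) (x : ℤ × ℤ → ℝ) :
    partialAverage μ Z f (insert a s) x
      = ∫ ω, partialAverage μ Z f s (Function.update x a (Z a ω)) ∂μ := by
  have hmZ := measurable_config hZ
  have hU := (measurable_update_zero a).comp hmZ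
  have hg : Measurable fun q : (ℤ × ℤ → ℝ) × ℝ => f (Function.update (hybrid s q.1 x) a q.2) :=
    hf.comp ((measurable_update_pair a).comp
      ((((measurable_hybrid s).comp (measurable_fst.prodMk measurable_const))).prodMk measurable_snd))
  have e : ∀ u : ℤ × ℤ → ℝ, hybrid s (Function.update u a 0) x = hybrid s u x := fun u => by
    funext p
    by_cases hp : p = a
    · subst hp; simp [hybrid, has]
    · simp [hybrid, hp]
  have key := integral_eq_integral_integral_of_indepFun hU (hZ a) hZind.symm hg
    (integrable_bounded_comp (hU.prodMk (hZ a)) hg fun _ => hC _)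
  simp only [Function.comp_apply, e] at key
  unfold partialAverage
  simp only [hybrid_update_of_notMem has]
  rw [← key]
  refine integral_congr_ae (Eventually.of_forall fun ω => congrArg f ?_)
  funext p
  by_cases hp : p = a
  · subst hp; simp [hybrid]
  · simp [hybrid, hp]

/-- For fixed other coordinates, averaging additionally over `a` replaces `g` by its mean in `Z a`,
so the difference of second moments is the average of the variances in that single coordinate.
Averaging over `s` preserves the Lipschitz constant. -/
theorem integral_sq_sub_partialAverage_insert_le (hZ : ∀ p, Measurable (Z p)) (hf : Measurable f)
    (hC : ∀ x, |f x| ≤ C) (hZL2 : MemLp (Z a) 2 μ)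
    (hL : ∀ w t, |f (Function.update w a t) - f (Function.update w a 0)| ≤ L * |t|)
    (hZind : IndepFun (Z a) (fun ω => Function.update (fun p => Z p ω) a 0) μ) (has : a ∉ s) :
    ∫ ω, partialAverage μ Z f s (fun p => Z p ω) ^ 2 ∂μ
      - ∫ ω, partialAverage μ Z f (insert a s) (fun p => Z p ω) ^ 2 ∂μ
      ≤ L ^ 2 * ∫ ω, Z a ω ^ 2 ∂μ := by
  have hmZ := measurable_config hZ
  have hU := (measurable_update_zero a).comp hmZ
  set g := partialAverage μ Z f s with hgdef
  have hg : Measurable g := measurable_partialAverage hZ hf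
  have hgC : ∀ x, |g x| ≤ C := abs_partialAverage_le hC
  have hup := (measurable_update_pair a)
  have hgs : Measurable fun q : ℝ × (ℤ × ℤ → ℝ) => g (Function.update q.2 a q.1) ^ 2 :=
    (hg.comp (hup.comp measurable_swap)).pow_const 2
  have hC2 : ∀ x, |g x ^ 2| ≤ C ^ 2 := fun x => by
    rw [abs_pow]; exact pow_le_pow_left₀ (abs_nonneg _) (hgC x) 2
  have key := integral_eq_integral_integral_of_indepFun (hZ a) hU hZind hgs
    (integrable_bounded_comp ((hZ a).prodMk hU) hgs fun _ => hC2 _)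
  simp only [Function.comp_apply, Function.update_idem] at key
  have e1 : ∀ ω, Function.update (fun p => Z p ω) a (Z a ω) = fun p => Z p ω := fun ω =>
    Function.update_eq_self a fun p => Z p ω
  simp only [e1] at key
  have e2 : ∀ ω', partialAverage μ Z f (insert a s) (fun p => Z p ω')
      = ∫ ω, g (Function.update (fun p => Z p ω') a (Z a ω)) ∂μ := fun ω' =>
    partialAverage_insert hZ hf hC hZind has _
  have hm : Measurable fun q : Ω × Ω => Function.update (fun p => Z p q.1) a (Z a q.2) :=
    hup.comp ((hmZ.comp measurable_fst).prodMk ((hZ a).comp measurable_snd))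
  have i1 : Integrable (fun ω' => ∫ ω, g (Function.update (fun p => Z p ω') a (Z a ω)) ^ 2 ∂μ) μ :=
    Integrable.of_bound ((hg.comp hm).pow_const 2).stronglyMeasurable.integral_prod_right'.aestronglyMeasurable
      (C ^ 2) (Eventually.of_forall fun ω' => abs_integral_le_of_bounded fun ω => hC2 _)
  have i2 : Integrable (fun ω' => (∫ ω, g (Function.update (fun p => Z p ω') a (Z a ω)) ∂μ) ^ 2) μ :=
    Integrable.of_bound
      ((hg.comp hm).stronglyMeasurable.integral_prod_right'.measurable.pow_const 2).aestronglyMeasurable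
      (C ^ 2) (Eventually.of_forall fun ω' => by
        rw [norm_pow]
        exact pow_le_pow_left₀ (norm_nonneg _) (abs_integral_le_of_bounded fun ω => hgC _) 2)
  simp only [e2]
  rw [key, ← integral_sub i1 i2]
  have hpt : ∀ ω', ∫ ω, g (Function.update (fun p => Z p ω') a (Z a ω)) ^ 2 ∂μ
      - (∫ ω, g (Function.update (fun p => Z p ω') a (Z a ω)) ∂μ) ^ 2
      ≤ L ^ 2 * ∫ ω, Z a ω ^ 2 ∂μ := fun ω' =>
    integral_sq_sub_sq_integral_le (h₀ := g (Function.update (fun p => Z p ω') a 0))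
      (hg.comp (hm.comp (measurable_const.prodMk measurable_id))) (fun ω => hgC _) hZL2
      (fun ω => partialAverage_lipschitz hZ hf hC hL has _ _)
  refine (integral_mono (i1.sub i2) (integrable_const _) hpt).trans (le_of_eq ?_)
  simp

/-- The Efron–Stein bound for a function of independent variables which is Lipschitz in each
coordinate. -/
theorem integral_sq_sub_sq_integral_le_sum {T : Finset (ℤ × ℤ)} (hZ : ∀ p, Measurable (Z p))
    (hf : Measurable f) (hC : ∀ x, |f x| ≤ C) (hZL2 : ∀ a ∈ T, MemLp (Z a) 2 μ)
    (hL : ∀ a w t, |f (Function.update w a t) - f (Function.update w a 0)| ≤ L * |t|)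
    (hZind : ∀ a ∈ T, IndepFun (Z a) (fun ω => Function.update (fun p => Z p ω) a 0) μ)
    (hT : ∀ w w' : ℤ × ℤ → ℝ, (∀ p ∈ T, w p = w' p) → f w = f w') :
    ∫ ω, f (fun p => Z p ω) ^ 2 ∂μ - (∫ ω, f (fun p => Z p ω) ∂μ) ^ 2
      ≤ L ^ 2 * ∑ a ∈ T, ∫ ω, Z a ω ^ 2 ∂μ := by
  have H : ∀ s : Finset (ℤ × ℤ), s ⊆ T →
      ∫ ω, f (fun p => Z p ω) ^ 2 ∂μ - ∫ ω, partialAverage μ Z f s (fun p => Z p ω) ^ 2 ∂μ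
        ≤ L ^ 2 * ∑ a ∈ s, ∫ ω, Z a ω ^ 2 ∂μ := by
    intro s
    induction s using Finset.induction_on with
    | empty =>
      intro _
      have : ∀ x : ℤ × ℤ → ℝ, partialAverage μ Z f ∅ x = f x := fun x => by
        have e : ∀ y, hybrid ∅ y x = x := fun y => by funext p; simp [hybrid]
        simp [partialAverage, e]
      simp [this]
    | insert a s has ih =>
      intro hsub
      have haT := hsub (Finset.mem_insert_self a s)
      have step := integral_sq_sub_partialAverage_insert_le hZ hf hC (hZL2 a haT) (hL a)
        (hZind a haT) has
      have := ih ((Finset.subset_insert a s).trans hsub)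
      rw [Finset.sum_insert has, mul_add]
      linarith
  -- Since `f` depends only on coordinates in `T`, the full average is constant and the telescoping
  -- ends at the squared mean.
  have e : ∀ x, partialAverage μ Z f T x = ∫ ω, f (fun p => Z p ω) ∂μ := fun x =>
    integral_congr_ae (Eventually.of_forall fun ω => hT _ _ fun p hp => by simp [hybrid, hp])
  have := H T subset_rfl
  simpa only [e, integral_const, probReal_univ, one_smul] using this

end Average

/-! ### Truncation estimates for single entries. -/

section Entries

variable {Ω : Type*} [MeasurableSpace Ω] {μ : Measure Ω} {f g : Ω → ℝ} {ε q : ℝ}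

/-- The absolute third moment of the standard Gaussian law. -/
def gaussianThirdMoment : ℝ :=
  ∫ x, |x| ^ 3 ∂gaussianReal 0 1

theorem gaussianThirdMoment_nonneg : 0 ≤ gaussianThirdMoment :=
  integral_nonneg fun _ => by positivity

theorem measurableSet_lt_abs (hf : Measurable f) (c : ℝ) : MeasurableSet {ω | c < |f ω|} :=
  measurableSet_lt measurable_const hf.abs

theorem integral_sq_mul_min_le (hε : 0 ≤ ε) (hq : 0 < q) (hf : Measurable f) (hf2 : MemLp f 2 μ) :
    ∫ ω, f ω ^ 2 * min 1 (1 / q * |f ω|) ∂μ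
      ≤ ∫ ω in {ω | ε * q < |f ω|}, f ω ^ 2 ∂μ + ε * ∫ ω, f ω ^ 2 ∂μ := by
  have hA := measurableSet_lt_abs hf (ε * q)
  have i := hf2.integrable_sq
  rw [← integral_indicator hA, ← integral_const_mul, ← integral_add (i.indicator hA) (i.const_mul ε)]
  refine integral_mono (integrable_mul_min (by positivity) i hf) ((i.indicator hA).add (i.const_mul ε))
    fun ω => ?_
  simp only [Set.indicator_apply, Set.mem_ofPred_eq]
  split_ifs with h
  · have h1 : f ω ^ 2 * min 1 (1 / q * |f ω|) ≤ f ω ^ 2 * 1 := by gcongr; exact min_le_left _ _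
    have : 0 ≤ ε * f ω ^ 2 := by positivity
    linarith
  · have h1 : f ω ^ 2 * min 1 (1 / q * |f ω|) ≤ f ω ^ 2 * ε := by
      gcongr
      refine (min_le_right _ _).trans ?_
      rw [one_div, inv_mul_le_iff₀ hq]; linarith
    linarith

theorem integral_sq_le_tail_add [IsProbabilityMeasure μ] (hf : Measurable f) (hf2 : MemLp f 2 μ) :
    ∫ ω, f ω ^ 2 ∂μ ≤ ∫ ω in {ω | ε * q < |f ω|}, f ω ^ 2 ∂μ + ε ^ 2 * q ^ 2 := by
  have hA := measurableSet_lt_abs hf (ε * q)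
  have i := hf2.integrable_sq
  have e : ε ^ 2 * q ^ 2 = ∫ _ω, ε ^ 2 * q ^ 2 ∂μ := by simp
  rw [← integral_indicator hA, e, ← integral_add (i.indicator hA) (integrable_const _)]
  refine integral_mono i ((i.indicator hA).add (integrable_const _)) fun ω => ?_
  simp only [Set.indicator_apply, Set.mem_ofPred_eq]
  split_ifs with h
  · nlinarith [mul_nonneg (sq_nonneg ε) (sq_nonneg q)]
  · have := pow_le_pow_left₀ (abs_nonneg _) (not_lt.1 h) 2
    rw [sq_abs, mul_pow] at this
    linarith

/-- A variance is controlled by the truncated variance, or it is small. -/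
theorem variance_dichotomy [IsProbabilityMeasure μ] (hf : Measurable f) (hf2 : MemLp f 2 μ) :
    ∫ ω, f ω ^ 2 ∂μ ≤ 2 * ∫ ω in {ω | ε * q < |f ω|}, f ω ^ 2 ∂μ
      ∨ ∫ ω, f ω ^ 2 ∂μ ≤ 2 * (ε * q) ^ 2 := by
  have := integral_sq_le_tail_add (ε := ε) (q := q) hf hf2
  by_contra! h
  nlinarith [h.1, h.2]

theorem tail_nonneg : 0 ≤ ∫ ω in {ω | ε * q < |f ω|}, f ω ^ 2 ∂μ :=
  integral_nonneg fun _ => sq_nonneg _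

theorem sqrt_le_of_le_two_mul_sq {v x : ℝ} (hx : 0 ≤ x) (h : v ≤ 2 * x ^ 2) :
    Real.sqrt v ≤ 2 * x :=
  Real.sqrt_le_iff.2 ⟨by positivity, by nlinarith [sq_nonneg x]⟩

theorem memLp_of_map_gaussianReal {v : ℝ≥0} (hg : Measurable g)
    (hlaw : μ.map g = gaussianReal 0 v) (p : ℝ≥0) : MemLp g p μ := by
  have h := memLp_id_gaussianReal (μ := 0) (v := v) p
  rw [← hlaw] at h
  exact (memLp_map_measure_iff aestronglyMeasurable_id hg.aemeasurable).1 h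

theorem integral_of_map_gaussianReal {v : ℝ≥0} (hg : Measurable g)
    (hlaw : μ.map g = gaussianReal 0 v) : ∫ ω, g ω ∂μ = 0 := by
  have h := integral_map (f := fun x : ℝ => x) hg.aemeasurable (μ := μ) (by fun_prop)
  rw [hlaw, integral_id_gaussianReal] at h
  exact h.symm

theorem integral_sq_of_map_gaussianReal {v : ℝ≥0} (hg : Measurable g)
    (hlaw : μ.map g = gaussianReal 0 v) : ∫ ω, g ω ^ 2 ∂μ = v := by
  have h := integral_map (f := fun x : ℝ => x ^ 2) hg.aemeasurable (μ := μ) (by fun_prop)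
  have h2 := variance_id_gaussianReal (μ := 0) (v := v)
  rw [variance_of_integral_eq_zero aemeasurable_id (by simp)] at h2
  rw [← h, hlaw]
  exact h2

theorem integral_abs_cube_of_map_gaussianReal {v : ℝ≥0} (hg : Measurable g)
    (hlaw : μ.map g = gaussianReal 0 v) :
    ∫ ω, |g ω| ^ 3 ∂μ = Real.sqrt v ^ 3 * gaussianThirdMoment := by
  have h := integral_map (f := fun x : ℝ => |x| ^ 3) hg.aemeasurable (μ := μ) (by fun_prop)
  have h2 : (gaussianReal 0 1).map (Real.sqrt v * ·) = gaussianReal 0 v := by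
    rw [gaussianReal_map_const_mul, mul_zero]
    congr 1
    ext
    simp
  rw [← h, hlaw, ← h2, integral_map (by fun_prop) (by fun_prop), gaussianThirdMoment,
    ← integral_const_mul]
  simp only [abs_mul, mul_pow, abs_of_nonneg (Real.sqrt_nonneg _)]

/-- This transfers the Lindeberg condition to the Gaussian entry. Either the tail of `f` dominates
the variance `v`, and `min ≤ 1` suffices, or `√v ≤ 2 ε q`, and the third moment, proportional to `v
* √v`, is small relative to `q * v`. -/
theorem integral_gaussian_sq_mul_min_le [IsProbabilityMeasure μ] (hε : 0 ≤ ε) (hq : 0 < q) (hf : Measurable f)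
    (hf2 : MemLp f 2 μ) (hg : Measurable g)
    (hlaw : μ.map g = gaussianReal 0 (Real.toNNReal (∫ ω, f ω ^ 2 ∂μ))) :
    ∫ ω, g ω ^ 2 * min 1 (1 / q * |g ω|) ∂μ
      ≤ 2 * ∫ ω in {ω | ε * q < |f ω|}, f ω ^ 2 ∂μ
        + 2 * gaussianThirdMoment * ε * ∫ ω, f ω ^ 2 ∂μ := by
  have hv0 : 0 ≤ ∫ ω, f ω ^ 2 ∂μ := integral_nonneg fun _ => sq_nonneg _
  have ht := tail_nonneg (μ := μ) (f := f) (ε := ε) (q := q)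
  have hκ := gaussianThirdMoment_nonneg
  have hsq := integral_sq_of_map_gaussianReal hg hlaw
  have hcube := integral_abs_cube_of_map_gaussianReal hg hlaw
  rw [Real.coe_toNNReal _ hv0] at hsq hcube
  have i2 : Integrable (fun ω => g ω ^ 2) μ :=
    (memLp_of_map_gaussianReal hg hlaw 2).integrable_sq
  have i3 : Integrable (fun ω => |g ω| ^ 3) μ := by
    have := (memLp_of_map_gaussianReal hg hlaw 3).integrable_norm_pow (p := 3) (by norm_num)
    exact this
  have im := integrable_mul_min (r := 1 / q) (by positivity) i2 hg
  rcases variance_dichotomy (ε := ε) (q := q) hf hf2 with h | h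
  · have h1 : ∫ ω, g ω ^ 2 * min 1 (1 / q * |g ω|) ∂μ ≤ ∫ ω, g ω ^ 2 ∂μ :=
      integral_mono im i2 fun ω => mul_le_of_le_one_right (sq_nonneg _) (min_le_left _ _)
    have : 0 ≤ 2 * gaussianThirdMoment * ε * ∫ ω, f ω ^ 2 ∂μ := by positivity
    linarith
  · have h1 : ∫ ω, g ω ^ 2 * min 1 (1 / q * |g ω|) ∂μ ≤ 1 / q * ∫ ω, |g ω| ^ 3 ∂μ := by
      rw [← integral_const_mul]
      refine integral_mono im (i3.const_mul _) fun ω => ?_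
      calc g ω ^ 2 * min 1 (1 / q * |g ω|) ≤ g ω ^ 2 * (1 / q * |g ω|) := by
            gcongr; exact min_le_right _ _
        _ = _ := by rw [← sq_abs]; ring
    have h2 := sqrt_le_of_le_two_mul_sq (by positivity) h
    rw [hcube] at h1
    set v := ∫ ω, f ω ^ 2 ∂μ
    have h3 : Real.sqrt v ^ 3 = v * Real.sqrt v := by
      rw [pow_succ, Real.sq_sqrt hv0]
    have h4 : 1 / q * (Real.sqrt v ^ 3 * gaussianThirdMoment)
        ≤ 1 / q * (v * (2 * (ε * q)) * gaussianThirdMoment) := by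
      rw [h3]; gcongr
    have h5 : 1 / q * (v * (2 * (ε * q)) * gaussianThirdMoment)
        = 2 * gaussianThirdMoment * ε * v := by field_simp
    linarith

/-- No joint information on `f` and `g` is needed: where `|f| ≤ ε q`, the product is at most `ε |f|
|g|`, and the arithmetic-geometric inequality separates the two. In the variance term `√v` plays the
role of `|f|`, through `variance_dichotomy`. -/
theorem integral_min_mul_le [IsProbabilityMeasure μ] (hε : 0 ≤ ε) (hq : 0 < q) (hf : Measurable f) (hf2 : MemLp f 2 μ)
    (hg : Measurable g) (hg2 : MemLp g 2 μ) :
    ∫ ω, min 1 (1 / q * |g ω|) * (f ω ^ 2 + ∫ ω', f ω' ^ 2 ∂μ) ∂μ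
      ≤ 3 * ∫ ω in {ω | ε * q < |f ω|}, f ω ^ 2 ∂μ
        + 2 * ε * (∫ ω, f ω ^ 2 ∂μ + ∫ ω, g ω ^ 2 ∂μ) := by
  set v := ∫ ω', f ω' ^ 2 ∂μ with hv
  set t := ∫ ω in {ω | ε * q < |f ω|}, f ω ^ 2 ∂μ with ht
  have hv0 : 0 ≤ v := integral_nonneg fun _ => sq_nonneg _
  have hg0 : 0 ≤ ∫ ω, g ω ^ 2 ∂μ := integral_nonneg fun _ => sq_nonneg _
  have ht0 : 0 ≤ t := tail_nonneg
  have hA := measurableSet_lt_abs hf (ε * q)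
  have i := hf2.integrable_sq
  have j := hg2.integrable_sq
  have comm : ∀ {h : Ω → ℝ}, Integrable h μ →
      Integrable (fun ω => min 1 (1 / q * |g ω|) * h ω) μ := fun hh =>
    (integrable_mul_min (by positivity) hh hg).congr (Eventually.of_forall fun ω => mul_comm _ _)
  have s1 := comm i
  have s2 := comm (integrable_const (μ := μ) v)
  simp_rw [mul_add]
  rw [integral_add s1 s2]
  have b1 : ∫ ω, min 1 (1 / q * |g ω|) * f ω ^ 2 ∂μ
      ≤ t + ε / 2 * (v + ∫ ω, g ω ^ 2 ∂μ) := by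
    have ij : Integrable (fun ω => ε / 2 * (f ω ^ 2 + g ω ^ 2)) μ := (i.add j).const_mul _
    rw [ht, ← integral_indicator hA, hv, ← integral_add i j, ← integral_const_mul,
      ← integral_add (i.indicator hA) ij]
    refine integral_mono s1 ((i.indicator hA).add ij) fun ω => ?_
    simp only [Set.indicator_apply, Set.mem_ofPred_eq]
    split_ifs with h
    · have h1 : min 1 (1 / q * |g ω|) * f ω ^ 2 ≤ 1 * f ω ^ 2 := by gcongr; exact min_le_left _ _
      have : 0 ≤ ε / 2 * (f ω ^ 2 + g ω ^ 2) := by positivity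
      linarith
    · have h1 : min 1 (1 / q * |g ω|) * f ω ^ 2 ≤ 1 / q * |g ω| * (|f ω| * (ε * q)) := by
        rw [← sq_abs, pow_two]
        gcongr
        · exact min_le_right _ _
        · exact not_lt.1 h
      have h2 : 1 / q * |g ω| * (|f ω| * (ε * q)) = ε * (|f ω| * |g ω|) := by field_simp
      have h3 : |f ω| * |g ω| ≤ (f ω ^ 2 + g ω ^ 2) / 2 := by
        rw [← sq_abs (f ω), ← sq_abs (g ω)]; nlinarith [sq_nonneg (|f ω| - |g ω|)]
      have h4 := mul_le_mul_of_nonneg_left h3 hε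
      linarith
  have b2 : ∫ ω, min 1 (1 / q * |g ω|) * v ∂μ ≤ 2 * t + ε * (v + ∫ ω, g ω ^ 2 ∂μ) := by
    rcases variance_dichotomy (ε := ε) (q := q) hf hf2 with h | h
    · have h1 : ∫ ω, min 1 (1 / q * |g ω|) * v ∂μ ≤ ∫ _ω, v ∂μ :=
        integral_mono s2 (integrable_const v) fun ω => mul_le_of_le_one_left hv0 (min_le_left _ _)
      have h2 : ∫ _ω, v ∂μ = v := by simp
      have : 0 ≤ ε * (v + ∫ ω, g ω ^ 2 ∂μ) := by positivity
      linarith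
    · have h2 := sqrt_le_of_le_two_mul_sq (by positivity) h
      have hsq := Real.mul_self_sqrt hv0
      have e : v + ∫ ω, g ω ^ 2 ∂μ = ∫ ω, (v + g ω ^ 2) ∂μ := by
        rw [integral_add (integrable_const v) j]; simp
      have h3 : ∫ ω, min 1 (1 / q * |g ω|) * v ∂μ ≤ ε * (v + ∫ ω, g ω ^ 2 ∂μ) := by
        rw [e, ← integral_const_mul]
        refine integral_mono s2 (((integrable_const v).add j).const_mul _) fun ω => ?_
        have h4 : min 1 (1 / q * |g ω|) * v ≤ 1 / q * |g ω| * (Real.sqrt v * (2 * (ε * q))) := by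
          conv_lhs => rw [← hsq]
          gcongr
          exact min_le_right _ _
        have h5 : 1 / q * |g ω| * (Real.sqrt v * (2 * (ε * q))) = ε * (2 * (Real.sqrt v * |g ω|)) := by
          field_simp
        have h6 : 2 * (Real.sqrt v * |g ω|) ≤ v + g ω ^ 2 := by
          rw [← sq_abs (g ω)]; nlinarith [sq_nonneg (Real.sqrt v - |g ω|)]
        have h7 := mul_le_mul_of_nonneg_left h6 hε
        linarith
      linarith
  have : 0 ≤ ε / 2 * (v + ∫ ω, g ω ^ 2 ∂μ) := by positivity
  linarith

end Entries

/-! ### Summation of the exchange errors over the triangle. -/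

/-- The indices of the lower triangle of an `n × n` matrix. -/
def lowerIndex (n : ℕ) : Finset (ℤ × ℤ) :=
  (Finset.Icc (1 : ℤ) n ×ˢ Finset.Icc (1 : ℤ) n).filter fun p => p.2 ≤ p.1

theorem mem_lowerIndex {n : ℕ} {p : ℤ × ℤ} :
    p ∈ lowerIndex n ↔ 1 ≤ p.2 ∧ p.2 ≤ p.1 ∧ p.1 ≤ n := by
  simp only [lowerIndex, Finset.mem_filter, Finset.mem_product, Finset.mem_Icc]
  omega

theorem lowerSum_eq_sum {M : Type*} [AddCommMonoid M] (n : ℕ) (f : ℤ → ℤ → M) :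
    lowerSum n f = ∑ p ∈ lowerIndex n, f p.1 p.2 := by
  refine (Finset.sum_finset_product' _ _ _ fun p => ?_).symm
  simp only [mem_lowerIndex, Finset.mem_Icc]
  omega

theorem card_window_le (T : Finset (ℤ × ℤ)) (b : ℕ) (a : ℤ × ℤ) :
    ((window T b a).card : ℝ) ≤ (2 * b : ℝ) ^ 2 := by
  have hsub : window T b a ⊆ Finset.Ioo (a.1 - b) (a.1 + b) ×ˢ Finset.Ioo (a.2 - b) (a.2 + b) := by
    intro p hp
    have h := (Finset.mem_filter.1 hp).2
    have h1 := abs_lt.1 (lt_of_le_of_lt (le_max_left _ _) h)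
    have h2 := abs_lt.1 (lt_of_le_of_lt (le_max_right _ _) h)
    simp only [Finset.mem_product, Finset.mem_Ioo]
    omega
  have h := Finset.card_le_card hsub
  rw [Finset.card_product, Int.card_Ioo, Int.card_Ioo] at h
  have h1 : ∀ x : ℤ, (x + b - (x - b) - 1).toNat ≤ 2 * b := fun x => by omega
  have h2 := h.trans (Nat.mul_le_mul (h1 _) (h1 _))
  rw [pow_two]
  exact_mod_cast h2

/-- Being in each other's window is symmetric, so after swapping the sums each `V a` is counted once
per neighbour. -/
theorem sum_window_le (T : Finset (ℤ × ℤ)) (b : ℕ) {V : ℤ × ℤ → ℝ} (hV : ∀ a, 0 ≤ V a) :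
    ∑ a ∈ T, ∑ l ∈ window T b a, V l ≤ (2 * b : ℝ) ^ 2 * ∑ a ∈ T, V a := by
  have h : ∀ x y, x ∈ T ∧ y ∈ window T b x ↔ x ∈ window T b y ∧ y ∈ T := fun x y => by
    simp only [window, Finset.mem_filter, abs_sub_comm y.1, abs_sub_comm y.2]
    tauto
  rw [Finset.sum_comm' h, Finset.mul_sum]
  refine Finset.sum_le_sum fun a _ => ?_
  rw [Finset.sum_const, nsmul_eq_mul]
  exact mul_le_mul_of_nonneg_right (card_window_le T b a) (hV a)

theorem sum_exchangeError_le {Ω : Type*} [MeasurableSpace Ω] {μ : Measure Ω}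
    [IsProbabilityMeasure μ] {X Z : ℤ × ℤ → Ω → ℝ} {T : Finset (ℤ × ℤ)} {ε q : ℝ} (hε : 0 ≤ ε)
    (hq : 0 < q) (hXmeas : ∀ p, Measurable (X p)) (hXL2 : ∀ p, MemLp (X p) 2 μ)
    (hZmeas : ∀ p, Measurable (Z p))
    (hlaw : ∀ a ∈ T, μ.map (Z a) = gaussianReal 0 (Real.toNNReal (∫ ω, X a ω ^ 2 ∂μ))) (b : ℕ) :
    ∑ a ∈ T, exchangeError μ X Z T b (1 / q) a
      ≤ (3 + 3 * (2 * b : ℝ) ^ 2) * (∑ a ∈ T, ∫ ω in {ω | ε * q < |X a ω|}, X a ω ^ 2 ∂μ)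
        + ε * (1 + 2 * gaussianThirdMoment + 4 * (2 * b : ℝ) ^ 2) * (∑ a ∈ T, ∫ ω, X a ω ^ 2 ∂μ)
        + ∑ a ∈ T, ∫ ω, |(μ[fun ω => X a ω ^ 2 - ∫ ω', X a ω' ^ 2 ∂μ |
            pastSigma X b a.1 a.2]) ω| ∂μ := by
  set V : ℤ × ℤ → ℝ := fun a => ∫ ω, X a ω ^ 2 ∂μ with hV
  set t : ℤ × ℤ → ℝ := fun a => ∫ ω in {ω | ε * q < |X a ω|}, X a ω ^ 2 ∂μ with ht
  set m : ℤ × ℤ → ℝ := fun a => ∫ ω, |(μ[fun ω => X a ω ^ 2 - ∫ ω', X a ω' ^ 2 ∂μ |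
            pastSigma X b a.1 a.2]) ω| ∂μ with hm
  have hV0 : ∀ a, 0 ≤ V a := fun a => integral_nonneg fun _ => sq_nonneg _
  have ht0 : ∀ a, 0 ≤ t a := fun a => tail_nonneg
  have hterm : ∀ a ∈ T, exchangeError μ X Z T b (1 / q) a
      ≤ (3 + 3 * (2 * b : ℝ) ^ 2) * t a + ε * (1 + 2 * gaussianThirdMoment + 2 * (2 * b : ℝ) ^ 2) * V a
        + m a + 2 * ε * ∑ l ∈ window T b a, V l := fun a ha => by
    have h1 := integral_sq_mul_min_le (ε := ε) hε hq (hXmeas a) (hXL2 a)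
    have h2 := integral_gaussian_sq_mul_min_le (ε := ε) hε hq (hXmeas a) (hXL2 a) (hZmeas a) (hlaw a ha)
    have h3 : ∑ l ∈ window T b a, ∫ ω, min 1 (1 / q * |X l ω|) * (X a ω ^ 2 + ∫ ω', X a ω' ^ 2 ∂μ) ∂μ
        ≤ ∑ l ∈ window T b a, (3 * t a + 2 * ε * (V a + V l)) :=
      Finset.sum_le_sum fun l _ => integral_min_mul_le hε hq (hXmeas a) (hXL2 a) (hXmeas l) (hXL2 l)
    have h4 : ∑ l ∈ window T b a, (3 * t a + 2 * ε * (V a + V l))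
        = (window T b a).card * (3 * t a + 2 * ε * V a) + 2 * ε * ∑ l ∈ window T b a, V l := by
      rw [Finset.mul_sum, ← nsmul_eq_mul, ← Finset.sum_const, ← Finset.sum_add_distrib]
      exact Finset.sum_congr rfl fun l _ => by ring
    have h5 := mul_le_mul_of_nonneg_right (card_window_le T b a)
      (show 0 ≤ 3 * t a + 2 * ε * V a by have := hV0 a; have := ht0 a; positivity)
    unfold exchangeError
    linarith
  refine (Finset.sum_le_sum hterm).trans ?_
  have hw := mul_le_mul_of_nonneg_left (sum_window_le T b hV0) (show 0 ≤ 2 * ε by positivity)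
  simp only [Finset.sum_add_distrib, ← Finset.mul_sum]
  linarith

/-! ### The Gaussian field on the whole lattice. -/

/-- A field indexed by the pairs of positive integers, extended by `0` to `ℤ × ℤ`. -/
def extendField {Ω : Type*} (Y : ℕ+ × ℕ+ → Ω → ℝ) (p : ℤ × ℤ) (ω : Ω) : ℝ :=
  if 0 < p.1 ∧ 0 < p.2 then Y (p.1.toNat.toPNat', p.2.toNat.toPNat') ω else 0

theorem extendField_toIntPair {Ω : Type*} (Y : ℕ+ × ℕ+ → Ω → ℝ) (q : ℕ+ × ℕ+) :
    extendField Y (toIntPair q) = Y q := by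
  funext ω
  have h1 := q.1.pos
  have h2 := q.2.pos
  rw [extendField, if_pos ⟨by simp [toIntPair], by simp [toIntPair]⟩]
  simp [toIntPair]

theorem exists_toIntPair_eq {p : ℤ × ℤ} (h1 : 0 < p.1) (h2 : 0 < p.2) : ∃ q, toIntPair q = p := by
  refine ⟨(⟨p.1.toNat, by omega⟩, ⟨p.2.toNat, by omega⟩), ?_⟩
  ext <;> simp only [toIntPair, PNat.mk_coe] <;> omega

theorem measurable_extendField {Ω : Type*} [MeasurableSpace Ω] {Y : ℕ+ × ℕ+ → Ω → ℝ}
    (hY : ∀ q, Measurable (Y q)) (p : ℤ × ℤ) : Measurable (extendField Y p) := by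
  unfold extendField
  split_ifs <;> fun_prop

theorem indepFun_extendField {Ω : Type*} [MeasurableSpace Ω] {μ : Measure Ω}
    {X : ℤ × ℤ → Ω → ℝ} {Y : ℕ+ × ℕ+ → Ω → ℝ}
    (hXY : IndepFun (fun ω p => X p ω) (fun ω p => Y p ω) μ) :
    IndepFun (fun ω p => X p ω) (fun ω p => extendField Y p ω) μ := by
  have hm : Measurable fun (y : ℕ+ × ℕ+ → ℝ) (p : ℤ × ℤ) =>
      if 0 < p.1 ∧ 0 < p.2 then y (p.1.toNat.toPNat', p.2.toNat.toPNat') else 0 := by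
    refine measurable_config fun p => ?_
    split_ifs <;> fun_prop
  exact hXY.comp measurable_id hm

/-- The two sides are measurable for the σ-fields generated by the disjoint index sets `{q}` and
`{q}ᶜ`; coordinates off the positive quadrant are constant. -/
theorem indepFun_update_extendField {Ω : Type*} [MeasurableSpace Ω] {μ : Measure Ω}
    {Y : ℕ+ × ℕ+ → Ω → ℝ} (hY : ∀ q, Measurable (Y q)) (hind : iIndepFun Y μ) (q : ℕ+ × ℕ+) :
    IndepFun (extendField Y (toIntPair q))
      (fun ω => Function.update (fun p => extendField Y p ω) (toIntPair q) 0) μ := by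
  rw [extendField_toIntPair]
  have h := indep_iSup_of_disjoint (fun i => (hY i).comap_le) hind.iIndep
    (S := {q}) (T := {q}ᶜ) disjoint_compl_right
  rw [IndepFun_iff_Indep]
  refine indep_of_indep_of_le h ?_ ?_
  · exact le_iSup₂ (f := fun i _ => MeasurableSpace.comap (Y i) _) q (Set.mem_singleton q)
  · rw [← measurable_iff_comap_le]
    refine measurable_config fun p => ?_
    simp only [Function.update_apply]
    by_cases hp : p = toIntPair q
    · simp only [hp, if_true]; exact measurable_const
    simp only [hp, if_false]
    by_cases hpos : 0 < p.1 ∧ 0 < p.2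
    · obtain ⟨q', rfl⟩ := exists_toIntPair_eq hpos.1 hpos.2
      rw [extendField_toIntPair, measurable_iff_comap_le]
      exact le_iSup₂ (f := fun i _ => MeasurableSpace.comap (Y i) _) q' fun e => hp (by rw [e])
    · simp only [extendField, hpos, if_false]; exact measurable_const

theorem traceResolvent_congr {n : ℕ} {z : ℂ} {w w' : ℤ × ℤ → ℝ}
    (h : ∀ p ∈ lowerIndex n, w p = w' p) : traceResolvent n z w = traceResolvent n z w' := by
  have := complexMatrix_congr (n := n) (w := w) (w' := w')
    fun p h1 h2 h3 => h p (mem_lowerIndex.2 ⟨h1, h2, h3⟩)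
  rw [traceResolvent, traceResolvent, resolventMatrix, resolventMatrix, this]

theorem eLpNorm_lowerSum_eq {Ω : Type*} [MeasurableSpace Ω] {μ : Measure Ω}
    {f : ℤ → ℤ → Ω → ℝ} (hf : ∀ i j, Integrable (f i j) μ) {n : ℕ} (hn : n ≠ 0) :
    ((n : ℝ≥0∞) ^ 2)⁻¹ * lowerSum n (fun i j => eLpNorm (f i j) 1 μ)
      = ENNReal.ofReal (1 / (n : ℝ) ^ 2 * ∑ a ∈ lowerIndex n, ∫ ω, |f a.1 a.2 ω| ∂μ) := by
  rw [lowerSum_eq_sum, ENNReal.ofReal_mul (by positivity),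
    ENNReal.ofReal_sum_of_nonneg fun a _ => integral_nonneg fun _ => abs_nonneg _]
  congr 1
  · rw [one_div, ENNReal.ofReal_inv_of_pos (by positivity), ENNReal.ofReal_pow (by positivity),
      ENNReal.ofReal_natCast]
  · refine Finset.sum_congr rfl fun a _ => ?_
    rw [eLpNorm_one_eq_lintegral_enorm, ← ofReal_integral_norm_eq_lintegral_enorm (hf _ _)]
    rfl

/-! ### Passage to the limit. -/

section Limit

variable {Ω : Type*} [MeasurableSpace Ω] {μ : Measure Ω} [IsProbabilityMeasure μ]
  {X Z : ℤ × ℤ → Ω → ℝ}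

theorem one_div_sqrt_pow_four (n : ℕ) : (1 / Real.sqrt n) ^ 4 = 1 / (n : ℝ) ^ 2 := by
  rw [div_pow, one_pow, show (4 : ℕ) = 2 * 2 from rfl, pow_mul, Real.sq_sqrt (Nat.cast_nonneg n)]

theorem tendsto_sum_exchangeError {C : ℝ} (hC : 0 < C) {D : ℕ → ℝ}
    (hXmeas : ∀ p, Measurable (X p)) (hXL2 : ∀ p, MemLp (X p) 2 μ)
    (hZmeas : ∀ p, Measurable (Z p))
    (hlaw : ∀ n, ∀ a ∈ lowerIndex n,
      μ.map (Z a) = gaussianReal 0 (Real.toNNReal (∫ ω, X a ω ^ 2 ∂μ)))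
    (hbound : BddAbove (Set.range fun n : ℕ =>
      (1 / (n : ℝ) ^ 2) * lowerSum n fun i j => ∫ ω, X (i, j) ω ^ 2 ∂μ))
    (hmix : Tendsto
      (fun a : ℕ => limsup
        (fun n : ℕ => ((n : ℝ≥0∞) ^ 2)⁻¹ * lowerSum n fun i j =>
          eLpNorm
            (μ[fun ω => X (i, j) ω ^ 2 - ∫ ω', X (i, j) ω' ^ 2 ∂μ | pastSigma X a i j]) 1 μ)
        atTop)
      atTop (𝓝 0))
    (hlind : ∀ ε : ℝ, 0 < ε → Tendsto
      (fun n : ℕ => (1 / (n : ℝ) ^ 2) * lowerSum n fun i j =>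
        ∫ ω in {ω | ε * Real.sqrt n < |X (i, j) ω|}, X (i, j) ω ^ 2 ∂μ)
      atTop (𝓝 0))
    (hD0 : ∀ n, 0 ≤ D n)
    (hD : ∀ n b : ℕ, n ≠ 0 → D n ≤ C * (1 / Real.sqrt n) ^ 4 *
      ∑ a ∈ lowerIndex n, exchangeError μ X Z (lowerIndex n) b (1 / Real.sqrt n) a) :
    Tendsto D atTop (𝓝 0) := by
  obtain ⟨M, hM⟩ := hbound
  have hM' : ∀ n : ℕ, 1 / (n : ℝ) ^ 2 * ∑ a ∈ lowerIndex n, ∫ ω, X a ω ^ 2 ∂μ ≤ M := fun n => by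
    have := hM ⟨n, rfl⟩
    simpa only [lowerSum_eq_sum] using this
  have hM0 : 0 ≤ M := by simpa using hM' 0
  simp only [lowerSum_eq_sum] at hlind
  rw [Metric.tendsto_atTop']
  suffices H : ∀ η > 0, ∀ᶠ n in atTop, D n < η by
    intro η hη
    obtain ⟨N, hN⟩ := eventually_atTop.1 (H η hη)
    refine ⟨N, fun n hn => ?_⟩
    rw [Real.dist_eq, sub_zero, abs_of_nonneg (hD0 n)]
    exact hN n hn.le
  intro η hη
  -- Each of three error groups gets the share `δ`. The window size `b` is fixed first by the mixing
  -- condition, then `ε` in terms of `b`, and only then is `n` taken large by the Lindeberg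
  -- condition. Dividing by `M + 1` below avoids a zero denominator.
  set δ := η / (3 * C) with hδ
  have hδ0 : 0 < δ := by positivity
  obtain ⟨b, hb⟩ := (hmix.eventually_lt_const (show (0 : ℝ≥0∞) < ENNReal.ofReal δ by simpa)).exists
  have hmixb := eventually_lt_of_limsup_lt hb
  set B := 1 + 2 * gaussianThirdMoment + 4 * (2 * b : ℝ) ^ 2 with hB
  have hB0 : 0 < B := by have := gaussianThirdMoment_nonneg; positivity
  set ε := δ / (B * (M + 1)) with hε
  have hε0 : 0 < ε := by positivity
  set m := 3 + 3 * (2 * b : ℝ) ^ 2 with hm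
  have hm0 : 0 < m := by positivity
  filter_upwards [hmixb, (hlind ε hε0).eventually_lt_const (show 0 < δ / m by positivity),
    eventually_ne_atTop 0] with n h1 h2 hn
  rw [eLpNorm_lowerSum_eq (fun i j => integrable_condExp) hn,
    ENNReal.ofReal_lt_ofReal_iff hδ0] at h1
  have hsum := sum_exchangeError_le (T := lowerIndex n) hε0.le
    (show 0 < Real.sqrt n from Real.sqrt_pos.2 (by positivity)) hXmeas hXL2 hZmeas (hlaw n) b
  refine (hD n b hn).trans_lt ?_
  rw [one_div_sqrt_pow_four, mul_assoc]
  have h3 := mul_le_mul_of_nonneg_left hsum (show 0 ≤ 1 / (n : ℝ) ^ 2 by positivity)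
  rw [lt_div_iff₀ hm0] at h2
  have h4 : ε * B * (1 / (n : ℝ) ^ 2 * ∑ a ∈ lowerIndex n, ∫ ω, X a ω ^ 2 ∂μ) ≤ δ := by
    have : ε * B * (M + 1) = δ := by rw [hε]; field_simp
    refine (mul_le_mul_of_nonneg_left (hM' n) (by positivity)).trans ?_
    have : 0 ≤ ε * B := by positivity
    linarith
  have h5 : 1 / (n : ℝ) ^ 2 * ∑ a ∈ lowerIndex n,
      exchangeError μ X Z (lowerIndex n) b (1 / Real.sqrt n) a < 3 * δ := by
    refine h3.trans_lt ?_
    linarith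
  calc _ < C * (3 * δ) := mul_lt_mul_of_pos_left h5 hC
    _ = η := by rw [hδ]; field_simp

/-- The traces of the resolvents of both matrix models concentrate around the same constants. -/
theorem tendsto_integral_sq_sub {z : ℂ} (hz : 0 < z.im) (ℓ : ℂ →L[ℝ] ℝ) (hℓ : ∀ x, |ℓ x| ≤ ‖x‖)
    (hXmeas : ∀ p, Measurable (X p)) (hXL2 : ∀ p, MemLp (X p) 2 μ)
    (hZmeas : ∀ p, Measurable (Z p))
    (hlaw : ∀ n, ∀ a ∈ lowerIndex n,
      μ.map (Z a) = gaussianReal 0 (Real.toNNReal (∫ ω, X a ω ^ 2 ∂μ)))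
    (hXZ : IndepFun (fun ω p => X p ω) (fun ω p => Z p ω) μ)
    (hZind : ∀ n, ∀ a ∈ lowerIndex n,
      IndepFun (Z a) (fun ω => Function.update (fun p => Z p ω) a 0) μ)
    (hmart : ∀ n, ∀ a ∈ lowerIndex n, μ[X a | pastSigma X 1 a.1 a.2] =ᵐ[μ] 0)
    (hbound : BddAbove (Set.range fun n : ℕ =>
      (1 / (n : ℝ) ^ 2) * lowerSum n fun i j => ∫ ω, X (i, j) ω ^ 2 ∂μ))
    (hmix : Tendsto
      (fun a : ℕ => limsup
        (fun n : ℕ => ((n : ℝ≥0∞) ^ 2)⁻¹ * lowerSum n fun i j =>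
          eLpNorm
            (μ[fun ω => X (i, j) ω ^ 2 - ∫ ω', X (i, j) ω' ^ 2 ∂μ | pastSigma X a i j]) 1 μ)
        atTop)
      atTop (𝓝 0))
    (hlind : ∀ ε : ℝ, 0 < ε → Tendsto
      (fun n : ℕ => (1 / (n : ℝ) ^ 2) * lowerSum n fun i j =>
        ∫ ω in {ω | ε * Real.sqrt n < |X (i, j) ω|}, X (i, j) ω ^ 2 ∂μ)
      atTop (𝓝 0)) :
    ∃ c : ℕ → ℝ,
      Tendsto (fun n => ∫ ω, (ℓ (traceResolvent n z fun p => X p ω) - c n) ^ 2 ∂μ) atTop (𝓝 0) ∧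
      Tendsto (fun n => ∫ ω, (ℓ (traceResolvent n z fun p => Z p ω) - c n) ^ 2 ∂μ) atTop (𝓝 0) := by
  set K := max 1 (1 / z.im) with hKdef
  have hK1 : 1 ≤ K := le_max_left _ _
  have hK : 1 / z.im ≤ K := le_max_right _ _
  have hmZ := measurable_config hZmeas
  have hf : ∀ n, Measurable fun w => ℓ (traceResolvent n z w) := fun n =>
    (ℓ.continuous.comp (continuous_const.mul
      (continuous_resolventMatrix n hz).matrix_trace)).measurable
  have hfK : ∀ n w, |ℓ (traceResolvent n z w)| ≤ K := fun n w =>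
    (hℓ _).trans (norm_traceResolvent_le hz hK w)
  -- Centering at the Gaussian mean makes the Gaussian integral a variance. The bound `|c n| ≤ K`
  -- keeps the expansion constants independent of `n`.
  set c : ℕ → ℝ := fun n => ∫ ω, ℓ (traceResolvent n z fun p => Z p ω) ∂μ with hc
  have hcK : ∀ n, |c n| ≤ K := fun n => abs_integral_le_of_bounded fun ω => hfK n _
  have hV0 : ∀ a, 0 ≤ ∫ ω, X a ω ^ 2 ∂μ := fun a => integral_nonneg fun _ => sq_nonneg _
  have hZL2 : ∀ n, ∀ a ∈ lowerIndex n, MemLp (Z a) 2 μ := fun n a ha =>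
    memLp_of_map_gaussianReal (hZmeas a) (hlaw n a ha) 2
  have hZvar : ∀ n, ∀ a ∈ lowerIndex n, ∫ ω, Z a ω ^ 2 ∂μ = ∫ ω, X a ω ^ 2 ∂μ := fun n a ha => by
    rw [integral_sq_of_map_gaussianReal (hZmeas a) (hlaw n a ha), Real.coe_toNNReal _ (hV0 a)]
  have hZlim : Tendsto (fun n => ∫ ω, (ℓ (traceResolvent n z fun p => Z p ω) - c n) ^ 2 ∂μ)
      atTop (𝓝 0) := by
    obtain ⟨M, hM⟩ := hbound
    refine squeeze_zero' (g := fun n : ℕ => 4 * K ^ 4 * M * (1 / (n : ℝ)))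
      (Eventually.of_forall fun n => integral_nonneg fun _ => sq_nonneg _) ?_ ?_
    · filter_upwards [eventually_ne_atTop 0] with n hn
      have i1 : Integrable (fun ω => ℓ (traceResolvent n z fun p => Z p ω)) μ :=
        integrable_bounded_comp hmZ (hf n) (hfK n)
      have i2 : Integrable (fun ω => ℓ (traceResolvent n z fun p => Z p ω) ^ 2) μ :=
        integrable_bounded_comp (C := K ^ 2) hmZ ((hf n).pow_const 2) fun w => by
          rw [abs_pow]; exact pow_le_pow_left₀ (abs_nonneg _) (hfK n w) 2
      have e : ∫ ω, (ℓ (traceResolvent n z fun p => Z p ω) - c n) ^ 2 ∂μ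
          = ∫ ω, ℓ (traceResolvent n z fun p => Z p ω) ^ 2 ∂μ
            - (∫ ω, ℓ (traceResolvent n z fun p => Z p ω) ∂μ) ^ 2 := by
        have e1 : ∀ ω, (ℓ (traceResolvent n z fun p => Z p ω) - c n) ^ 2
            = ℓ (traceResolvent n z fun p => Z p ω) ^ 2
              - 2 * c n * ℓ (traceResolvent n z fun p => Z p ω) + c n ^ 2 := fun ω => by ring
        have i3 : Integrable (fun ω => 2 * c n * ℓ (traceResolvent n z fun p => Z p ω)) μ :=
          i1.const_mul _
        have i4 : Integrable (fun ω => ℓ (traceResolvent n z fun p => Z p ω) ^ 2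
          - 2 * c n * ℓ (traceResolvent n z fun p => Z p ω)) μ := i2.sub i3
        simp_rw [e1]
        rw [integral_add i4 (integrable_const _), integral_sub i2 i3, integral_const_mul]
        simp only [hc, integral_const, probReal_univ, one_smul]
        ring
      -- The Lipschitz constant is of order `r ^ 3`. Its square times a variance sum of order `n ^
      -- 2` is of order `1 / n`.
      have hes := integral_sq_sub_sq_integral_le_sum (T := lowerIndex n)
        (L := 2 * K ^ 2 * (1 / Real.sqrt n) ^ 3) hZmeas (hf n) (hfK n) (hZL2 n)
        (fun a w t => by
          rw [← map_sub]
          exact (hℓ _).trans (norm_traceResolvent_update_sub_le hn hz hK a w t)) (hZind n)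
        (fun w w' h => congrArg ℓ (traceResolvent_congr h))
      rw [e]
      refine hes.trans ?_
      rw [Finset.sum_congr rfl (hZvar n)]
      have hMn : 1 / (n : ℝ) ^ 2 * ∑ a ∈ lowerIndex n, ∫ ω, X a ω ^ 2 ∂μ ≤ M := by
        have := hM ⟨n, rfl⟩
        simpa only [lowerSum_eq_sum] using this
      have hr2 : (1 / Real.sqrt n) ^ 2 = 1 / (n : ℝ) := by
        rw [div_pow, one_pow, Real.sq_sqrt (Nat.cast_nonneg n)]
      calc _ = 4 * K ^ 4 * (1 / (n : ℝ) ^ 2 * ∑ a ∈ lowerIndex n, ∫ ω, X a ω ^ 2 ∂μ)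
            * (1 / (n : ℝ)) := by
            rw [← one_div_sqrt_pow_four, ← hr2]; ring
        _ ≤ _ := by gcongr
    · have := (tendsto_one_div_atTop_nhds_zero_nat (𝕜 := ℝ)).const_mul (4 * K ^ 4 * M)
      rwa [mul_zero] at this
  refine ⟨c, ?_, hZlim⟩
  have hdiff := tendsto_sum_exchangeError (C := 12 * (8 * K ^ 4) ^ 2) (by positivity)
    (D := fun n => |∫ ω, (ℓ (traceResolvent n z fun p => X p ω) - c n) ^ 2 ∂μ
      - ∫ ω, (ℓ (traceResolvent n z fun p => Z p ω) - c n) ^ 2 ∂μ|)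
    hXmeas hXL2 hZmeas hlaw hbound hmix hlind (fun n => abs_nonneg _) fun n b hn => by
      have h := abs_integral_hybrid_sub_le (T := lowerIndex n) (by positivity)
        (hasExpansion_sq hn hz hK hK1 ℓ hℓ (hcK n)) hXmeas hXL2 hZmeas (hZL2 n) hXZ (hmart n)
        (hZind n) (fun a ha => integral_of_map_gaussianReal (hZmeas a) (hlaw n a ha)) (hZvar n)
        (fun p hp => (mem_lowerIndex.1 hp).2.1) b
      have e : ∀ ω, traceResolvent n z (hybrid (lowerIndex n) (fun p => X p ω) fun p => Z p ω)
          = traceResolvent n z fun p => X p ω := fun ω =>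
        traceResolvent_congr fun p hp => by simp [hybrid, hp]
      simpa only [e] using h
  have := (tendsto_zero_iff_abs_tendsto_zero _).2 hdiff
  simpa using this.add hZlim

end Limit

/-! ### Convergence in probability and conclusion. -/

/-- Chebyshev's inequality, with `(x - y) ^ 2 ≤ 2 (x - c) ^ 2 + 2 (y - c) ^ 2` for real and
imaginary parts; the centers `c n` and `d n` need not converge. -/
theorem tendstoInMeasure_of_re_im {Ω : Type*} [MeasurableSpace Ω] {μ : Measure Ω}
    [IsProbabilityMeasure μ] {F G : ℕ → Ω → ℂ} {K : ℝ} (hF : ∀ n, Measurable (F n))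
    (hG : ∀ n, Measurable (G n)) (hFK : ∀ n ω, ‖F n ω‖ ≤ K) (hGK : ∀ n ω, ‖G n ω‖ ≤ K)
    {c d : ℕ → ℝ}
    (h1 : Tendsto (fun n => ∫ ω, ((F n ω).re - c n) ^ 2 ∂μ) atTop (𝓝 0))
    (h2 : Tendsto (fun n => ∫ ω, ((G n ω).re - c n) ^ 2 ∂μ) atTop (𝓝 0))
    (h3 : Tendsto (fun n => ∫ ω, ((F n ω).im - d n) ^ 2 ∂μ) atTop (𝓝 0))
    (h4 : Tendsto (fun n => ∫ ω, ((G n ω).im - d n) ^ 2 ∂μ) atTop (𝓝 0)) :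
    TendstoInMeasure μ (fun n ω => F n ω - G n ω) atTop fun _ => (0 : ℂ) := by
  rw [tendstoInMeasure_iff_measureReal_norm]
  intro ε hε
  have hsum := ((((h1.add h2).add h3).add h4).const_mul 2).const_mul (1 / ε ^ 2)
  simp only [add_zero, mul_zero] at hsum
  refine squeeze_zero (fun n => measureReal_nonneg) (fun n => ?_) hsum
  have intb : ∀ {u : Ω → ℝ} (e : ℝ), Measurable u → (∀ ω, |u ω| ≤ K) →
      Integrable (fun ω => (u ω - e) ^ 2) μ := fun {u} e hu hK => by
    refine Integrable.of_bound (C := (K + |e|) ^ 2) (by fun_prop) (Eventually.of_forall fun ω => ?_)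
    rw [norm_pow]
    exact pow_le_pow_left₀ (norm_nonneg _)
      ((norm_sub_le _ _).trans (add_le_add (hK ω) le_rfl)) 2
  have i1 := intb (c n) (Complex.measurable_re.comp (hF n))
    fun ω => (Complex.abs_re_le_norm _).trans (hFK n ω)
  have i2 := intb (c n) (Complex.measurable_re.comp (hG n))
    fun ω => (Complex.abs_re_le_norm _).trans (hGK n ω)
  have i3 := intb (d n) (Complex.measurable_im.comp (hF n))
    fun ω => (Complex.abs_im_le_norm _).trans (hFK n ω)
  have i4 := intb (d n) (Complex.measurable_im.comp (hG n))
    fun ω => (Complex.abs_im_le_norm _).trans (hGK n ω)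
  simp only [Function.comp_apply] at i1 i2 i3 i4
  have i12 : Integrable (fun ω => ((F n ω).re - c n) ^ 2 + ((G n ω).re - c n) ^ 2) μ := i1.add i2
  have i123 : Integrable (fun ω => ((F n ω).re - c n) ^ 2 + ((G n ω).re - c n) ^ 2
    + ((F n ω).im - d n) ^ 2) μ := i12.add i3
  have i1234 : Integrable (fun ω => ((F n ω).re - c n) ^ 2 + ((G n ω).re - c n) ^ 2
    + ((F n ω).im - d n) ^ 2 + ((G n ω).im - d n) ^ 2) μ := i123.add i4
  have key := mul_meas_ge_le_integral_of_nonneg (μ := μ)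
    (f := fun ω => 2 * (((F n ω).re - c n) ^ 2 + ((G n ω).re - c n) ^ 2
    + ((F n ω).im - d n) ^ 2 + ((G n ω).im - d n) ^ 2))
    (Eventually.of_forall fun ω => by positivity) (i1234.const_mul 2) (ε ^ 2)
  rw [integral_const_mul, integral_add i123 i4, integral_add i12 i3, integral_add i1 i2] at key
  have hsub : {ω | ε ≤ ‖F n ω - G n ω - 0‖} ⊆ {ω | ε ^ 2 ≤
      2 * (((F n ω).re - c n) ^ 2 + ((G n ω).re - c n) ^ 2
        + ((F n ω).im - d n) ^ 2 + ((G n ω).im - d n) ^ 2)} := by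
    intro ω hω
    have hω' : ε ≤ ‖F n ω - G n ω - 0‖ := hω
    rw [sub_zero] at hω'
    have h5 := pow_le_pow_left₀ hε.le hω' 2
    rw [Complex.sq_norm, Complex.normSq_apply, Complex.sub_re, Complex.sub_im] at h5
    show ε ^ 2 ≤ _
    nlinarith [sq_nonneg ((F n ω).re - c n + ((G n ω).re - c n)),
      sq_nonneg ((F n ω).im - d n + ((G n ω).im - d n))]
  have hle := measureReal_mono (μ := μ) hsub
  rw [one_div, inv_mul_eq_div, le_div_iff₀ (by positivity), mul_comm]
  exact (mul_le_mul_of_nonneg_left hle (by positivity)).trans key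

end
end MartingaleMatrix

theorem mainTheorem1 {Ω : Type*} [MeasurableSpace Ω] (μ : Measure Ω) [IsProbabilityMeasure μ]
    (X : ℤ × ℤ → Ω → ℝ) (Y : ℕ+ × ℕ+ → Ω → ℝ)
    -- the random field `X`: centered, square integrable
    (hXmeas : ∀ p, Measurable (X p))
    (hXL2 : ∀ p, MemLp (X p) 2 μ)
    (hXmean : ∀ p, ∫ ω, X p ω ∂μ = 0)
    -- the Gaussian field `Y`: independent entries, centered, same variances, independent of `X`
    (hYmeas : ∀ p, Measurable (Y p))
    (hYlaw : ∀ p, μ.map (Y p)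
      = gaussianReal 0 (Real.toNNReal (∫ ω, X (MartingaleMatrix.toIntPair p) ω ^ 2 ∂μ)))
    (hYindep : iIndepFun Y μ)
    (hXY : IndepFun (fun ω p => X p ω) (fun ω p => Y p ω) μ)
    -- martingale difference condition
    (hmart : ∀ i j : ℤ, 1 ≤ j → j ≤ i →
      μ[X (i, j) | MartingaleMatrix.pastSigma X 1 i j] =ᵐ[μ] 0)
    -- variances bounded on average
    (hbound : BddAbove (Set.range fun n : ℕ =>
      (1 / (n : ℝ) ^ 2) * MartingaleMatrix.lowerSum n fun i j => ∫ ω, X (i, j) ω ^ 2 ∂μ))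
    -- mixing condition on the conditional variances
    (hmix : Tendsto
      (fun a : ℕ => limsup
        (fun n : ℕ => ((n : ℝ≥0∞) ^ 2)⁻¹ * MartingaleMatrix.lowerSum n fun i j =>
          eLpNorm
            (μ[fun ω => X (i, j) ω ^ 2 - ∫ ω', X (i, j) ω' ^ 2 ∂μ |
              MartingaleMatrix.pastSigma X a i j]) 1 μ)
        atTop)
      atTop (𝓝 0))
    -- Lindeberg condition
    (hlind : ∀ ε : ℝ, 0 < ε → Tendsto
      (fun n : ℕ => (1 / (n : ℝ) ^ 2) * MartingaleMatrix.lowerSum n fun i j =>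
        ∫ ω in {ω | ε * Real.sqrt n < |X (i, j) ω|}, X (i, j) ω ^ 2 ∂μ)
      atTop (𝓝 0)) :
    ∀ z : ℂ, 0 < z.im →
      TendstoInMeasure μ
        (fun (n : ℕ) ω =>
          MartingaleMatrix.matrixStieltjes n
              (fun i j => X (MartingaleMatrix.toIntPair (i, j)) ω) z
            - MartingaleMatrix.matrixStieltjes n (fun i j => Y (i, j) ω) z)
        atTop (fun _ => (0 : ℂ)) := by
  intro z hz
  -- Hybrids mix both fields on one index set, so `Y` is extended to the lattice; the added zeros
  -- never enter the matrices.
  set Z := MartingaleMatrix.extendField Y with hZdef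
  have hZmeas := MartingaleMatrix.measurable_extendField hYmeas
  have hXZ := MartingaleMatrix.indepFun_extendField hXY
  have hpos : ∀ n, ∀ a ∈ MartingaleMatrix.lowerIndex n, ∃ q, MartingaleMatrix.toIntPair q = a :=
    fun n a ha => by
      have h := MartingaleMatrix.mem_lowerIndex.1 ha
      exact MartingaleMatrix.exists_toIntPair_eq (by omega) (by omega)
  have hlaw : ∀ n, ∀ a ∈ MartingaleMatrix.lowerIndex n,
      μ.map (Z a) = gaussianReal 0 (Real.toNNReal (∫ ω, X a ω ^ 2 ∂μ)) := fun n a ha => by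
    obtain ⟨q, rfl⟩ := hpos n a ha
    rw [hZdef, MartingaleMatrix.extendField_toIntPair]
    exact hYlaw q
  have hZind : ∀ n, ∀ a ∈ MartingaleMatrix.lowerIndex n,
      IndepFun (Z a) (fun ω => Function.update (fun p => Z p ω) a 0) μ := fun n a ha => by
    obtain ⟨q, rfl⟩ := hpos n a ha
    exact MartingaleMatrix.indepFun_update_extendField hYmeas hYindep q
  have hmart' : ∀ n, ∀ a ∈ MartingaleMatrix.lowerIndex n,
      μ[X a | MartingaleMatrix.pastSigma X 1 a.1 a.2] =ᵐ[μ] 0 := fun n a ha => by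
    have h := MartingaleMatrix.mem_lowerIndex.1 ha
    exact hmart a.1 a.2 h.1 h.2.1
  obtain ⟨c, h1, h2⟩ := MartingaleMatrix.tendsto_integral_sq_sub hz Complex.reCLM
    Complex.abs_re_le_norm hXmeas hXL2 hZmeas hlaw hXZ hZind hmart' hbound hmix hlind
  obtain ⟨d, h3, h4⟩ := MartingaleMatrix.tendsto_integral_sq_sub hz Complex.imCLM
    Complex.abs_im_le_norm hXmeas hXL2 hZmeas hlaw hXZ hZind hmart' hbound hmix hlind
  have hs : ∀ n, Measurable (MartingaleMatrix.traceResolvent n z) := fun n =>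
    (continuous_const.mul (MartingaleMatrix.continuous_resolventMatrix n hz).matrix_trace).measurable
  have main := MartingaleMatrix.tendstoInMeasure_of_re_im
    (fun n => (hs n).comp (MartingaleMatrix.measurable_config hXmeas))
    (fun n => (hs n).comp (MartingaleMatrix.measurable_config hZmeas))
    (fun n ω => MartingaleMatrix.norm_traceResolvent_le hz le_rfl _)
    (fun n ω => MartingaleMatrix.norm_traceResolvent_le hz le_rfl _) h1 h2 h3 h4
  have e1 : ∀ n ω, MartingaleMatrix.matrixStieltjes n
      (fun i j => X (MartingaleMatrix.toIntPair (i, j)) ω) z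
      = MartingaleMatrix.traceResolvent n z fun p => X p ω := fun n ω =>
    MartingaleMatrix.matrixStieltjes_eq_traceResolvent hz fun p => X p ω
  have e2 : ∀ n ω, MartingaleMatrix.matrixStieltjes n (fun i j => Y (i, j) ω) z
      = MartingaleMatrix.traceResolvent n z fun p => Z p ω := fun n ω => by
    rw [← MartingaleMatrix.matrixStieltjes_eq_traceResolvent hz fun p => Z p ω]
    simp only [hZdef, MartingaleMatrix.extendField_toIntPair]
  simp only [e1, e2]
  exact main
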